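/- All $C^*$-algebras and $*$-homomorphisms below are unital (the zero algebra is admitted). Let $K>0$. An $m$-tuple $(y_1,\dots,y_m)$ of self-adjoint elements of a unital $C^*$-algebra $X$ is called *$K$-unessential* if for every rational $\delta>0$ there are self-adjoint $z_1,\dots,z_m\in X$ with $\|y_k-z_k\|\le\delta$ for all $k$ such that $\sum_{k} z_k^2$ is invertible and $\bigl\|\bigl(\sum_{k} z_k^2\bigr)^{-1}\bigr\|\le \frac{1}{K\delta^2}$. For an integer $n\ge 0$ we write $\operatorname{br}_K(X)\le n$ if for every $(n+1)$-tuple $(x_1,\dots,x_{n+1})$ of self-adjoint elements of $X$ and every $\varepsilon>0$ there is a $K$-unessential $(n+1)$-tuple $(y_1,\dots,y_{n+1})$ in $X$ with $\|x_k-y_k\|<\varepsilon$ for all $k$; the *bounded rank* $\operatorname{br}_K(X)$ is the least such $n$ ($\infty$ if there is none). Let $\mathcal{BR}_n^K$ be the class of all separable unital $C^*$-algebras $X$ with $\operatorname{br}_K(X)\le n$, and let $C^*(\mathbb F_\infty)$ be the full group $C^*$-algebra of the free group on countably infinitely many generators. **Theorem.** Let $K>0$ and let $n\ge 0$ be an integer.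 There exist an algebra $Z_n^K\in\mathcal{BR}_n^K$ and a unital $*$-homomorphism $p\colon C^*(\mathbb F_\infty)\to Z_n^K$ such that for every $X\in\mathcal{BR}_n^K$ and every unital $*$-homomorphism $g\colon C^*(\mathbb F_\infty)\to X$ there is a unital $*$-homomorphism $h\colon Z_n^K\to X$ with $g=h\circ p$. Consequently $Z_n^K$ is universal in $\mathcal{BR}_n^K$: every $X\in\mathcal{BR}_n^K$ is a quotient of $Z_n^K$, i.e. there is a surjective unital $*$-homomorphism $Z_n^K\to X$. Moreover, if $K\le n+1$, then $\operatorname{br}_K(Z_n^K)=n$. -/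

import Mathlib

/-! ## The full group C⋆-algebra of a discrete group -/

namespace MonoidAlgebra

variable {G : Type*} [Group G]

/-- The standard involution of the complex group algebra, `(∑ c_g g)⋆ = ∑ (conj c_g) g⁻¹`. -/
noncomputable instance instStarGroupAlgebra : Star (MonoidAlgebra ℂ G) where
  star a := a.coeff.sum fun g c => single g⁻¹ (star c)

theorem star_def (a : MonoidAlgebra ℂ G) :
    star a = a.coeff.sum fun g c => single g⁻¹ (star c) := rfl

theorem star_single' (g : G) (c : ℂ) :
    star (single g c : MonoidAlgebra ℂ G) = single g⁻¹ (star c) := by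
  rw [star_def, coeff_single, Finsupp.sum_single_index (by simp)]

theorem star_add' (a b : MonoidAlgebra ℂ G) : star (a + b) = star a + star b := by
  rw [star_def, star_def, star_def, coeff_add]
  exact Finsupp.sum_add_index' (by simp) (by simp [single_add])

theorem star_zero' : star (0 : MonoidAlgebra ℂ G) = 0 := by simp [star_def]

noncomputable instance instStarRingGroupAlgebra : StarRing (MonoidAlgebra ℂ G) where
  star_involutive a := by
    induction a using induction_linear with
    | zero => simp only [star_zero']
    | add f g hf hg => rw [star_add', star_add', hf, hg]
    | single g c => simp only [star_single', inv_inv, star_star]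
  star_mul a b := by
    induction a using induction_linear with
    | zero => simp only [star_zero', zero_mul, mul_zero]
    | add f g hf hg => rw [add_mul, star_add', star_add', hf, hg, mul_add]
    | single g c =>
      induction b using induction_linear with
      | zero => simp only [star_zero', zero_mul, mul_zero]
      | add f g hf hg => rw [mul_add, star_add', star_add', hf, hg, add_mul]
      | single h d => simp only [star_single', single_mul_single, mul_inv_rev, star_mul]
  star_add := star_add'

noncomputable instance instStarModuleGroupAlgebra : StarModule ℂ (MonoidAlgebra ℂ G) where
  star_smul c a := by
    induction a using induction_linear with
    | zero => simp only [star_zero', smul_zero]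
    | add f g hf hg => rw [smul_add, star_add', star_add', hf, hg, smul_add]
    | single g d => simp only [star_single', smul_single, star_smul]

end MonoidAlgebra

/-- A C⋆-seminorm on a complex ⋆-algebra: a submultiplicative seminorm satisfying the
C⋆-identity. -/
structure CStarSeminorm (A : Type*) [Ring A] [StarRing A] [Algebra ℂ A] extends Seminorm ℂ A where
  mul_le' : ∀ a b : A, toFun (a * b) ≤ toFun a * toFun b
  star_mul_self' : ∀ a : A, toFun (star a * a) = toFun a ^ 2

namespace CStarSeminorm

/-- The zero seminorm. -/
noncomputable instance instZero {A : Type*} [Ring A] [StarRing A] [Algebra ℂ A] : Zero (CStarSeminorm A) where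
  zero := { (0 : Seminorm ℂ A) with
    mul_le' := fun a b => by change (0 : ℝ) ≤ 0 * 0; simp
    star_mul_self' := fun a => by change (0 : ℝ) = 0 ^ 2; simp }

instance instNonempty {A : Type*} [Ring A] [StarRing A] [Algebra ℂ A] :
    Nonempty (CStarSeminorm A) := ⟨0⟩

section general

variable {A : Type*} [Ring A] [StarRing A] [Algebra ℂ A] (p : CStarSeminorm A)

theorem mul_le (a b : A) : p.toSeminorm (a * b) ≤ p.toSeminorm a * p.toSeminorm b :=
  p.mul_le' a b

theorem star_mul_self (a : A) : p.toSeminorm (star a * a) = p.toSeminorm a ^ 2 :=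
  p.star_mul_self' a

theorem one_le_one : p.toSeminorm 1 ≤ 1 := by
  have h := p.star_mul_self 1
  have h0 := apply_nonneg p.toSeminorm 1
  simp only [star_one, mul_one] at h
  nlinarith

end general

variable {G : Type*} [Group G]

/-- A C⋆-seminorm on a group algebra is dominated by the `ℓ¹`-norm of the coefficients. -/
theorem le_sum (p : CStarSeminorm (MonoidAlgebra ℂ G)) (a : MonoidAlgebra ℂ G) :
    p.toSeminorm a ≤ ∑ g ∈ a.coeff.support, ‖a.coeff g‖ := by
  have hg : ∀ g : G, p.toSeminorm (MonoidAlgebra.single g 1) ≤ 1 := by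
    intro g
    have h := p.star_mul_self (MonoidAlgebra.single g 1)
    rw [MonoidAlgebra.star_single', MonoidAlgebra.single_mul_single, inv_mul_cancel, star_one,
      mul_one, ← MonoidAlgebra.one_def] at h
    have h0 := apply_nonneg p.toSeminorm (MonoidAlgebra.single g 1)
    have h1 := p.one_le_one
    nlinarith
  have hs : ∀ (g : G) (c : ℂ), p.toSeminorm (MonoidAlgebra.single g c) ≤ ‖c‖ := by
    intro g c
    have : (MonoidAlgebra.single g c : MonoidAlgebra ℂ G) = c • MonoidAlgebra.single g 1 := by
      rw [MonoidAlgebra.smul_single, smul_eq_mul, mul_one]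
    rw [this, map_smul_eq_mul]
    exact mul_le_of_le_one_right (norm_nonneg c) (hg g)
  conv_lhs => rw [← MonoidAlgebra.sum_coeff_single a, Finsupp.sum]
  exact (Finset.le_sum_of_subadditive p.toSeminorm (map_zero p.toSeminorm).le
    (map_add_le_add p.toSeminorm) _ _).trans (Finset.sum_le_sum fun g _ => hs g _)

theorem bddAbove (a : MonoidAlgebra ℂ G) :
    BddAbove (Set.range fun p : CStarSeminorm (MonoidAlgebra ℂ G) => p.toSeminorm a) :=
  ⟨_, by rintro _ ⟨p, rfl⟩; exact p.le_sum a⟩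

end CStarSeminorm

/-- The full (universal) C⋆-norm of an element of the complex group algebra `ℂ[G]`: the supremum
of all C⋆-seminorms. By the Gelfand–Naimark theorem this is the supremum of `‖π a‖` over all
unitary representations `π` of `G`. -/
noncomputable def fullGroupNorm {G : Type*} [Group G] (a : MonoidAlgebra ℂ G) : ℝ :=
  ⨆ p : CStarSeminorm (MonoidAlgebra ℂ G), p.toSeminorm a

section fullGroupNorm

variable {G : Type*} [Group G]

theorem le_fullGroupNorm (p : CStarSeminorm (MonoidAlgebra ℂ G)) (a : MonoidAlgebra ℂ G) :
    p.toSeminorm a ≤ fullGroupNorm a := le_ciSup (CStarSeminorm.bddAbove a) p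

theorem fullGroupNorm_le {a : MonoidAlgebra ℂ G} {r : ℝ}
    (h : ∀ p : CStarSeminorm (MonoidAlgebra ℂ G), p.toSeminorm a ≤ r) : fullGroupNorm a ≤ r :=
  ciSup_le h

theorem fullGroupNorm_nonneg (a : MonoidAlgebra ℂ G) : 0 ≤ fullGroupNorm a :=
  (apply_nonneg _ _).trans (le_fullGroupNorm 0 a)

/-- The full C⋆-norm, as a ring seminorm on the group algebra. -/
noncomputable def fullGroupRingSeminorm (G : Type*) [Group G] :
    RingSeminorm (MonoidAlgebra ℂ G) where
  toFun := fullGroupNorm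
  map_zero' := by simp [fullGroupNorm]
  add_le' a b := fullGroupNorm_le fun p => (map_add_le_add p.toSeminorm a b).trans
    (add_le_add (le_fullGroupNorm p a) (le_fullGroupNorm p b))
  neg' a := by simp [fullGroupNorm]
  mul_le' a b := fullGroupNorm_le fun p => (p.mul_le a b).trans
    (mul_le_mul (le_fullGroupNorm p a) (le_fullGroupNorm p b) (apply_nonneg _ _)
      (fullGroupNorm_nonneg a))

noncomputable instance instSeminormedRingGroupAlgebra : SeminormedRing (MonoidAlgebra ℂ G) :=
  (fullGroupRingSeminorm G).toSeminormedRing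

theorem norm_groupAlgebra_def (a : MonoidAlgebra ℂ G) : ‖a‖ = fullGroupNorm a := rfl

noncomputable instance instNormedAlgebraGroupAlgebra : NormedAlgebra ℂ (MonoidAlgebra ℂ G) where
  norm_smul_le c a := fullGroupNorm_le fun p => by
    rw [map_smul_eq_mul]
    exact mul_le_mul_of_nonneg_left (le_fullGroupNorm p a) (norm_nonneg c)

theorem groupAlgebra_norm_sq_le (a : MonoidAlgebra ℂ G) : ‖a‖ * ‖a‖ ≤ ‖star a * a‖ := by
  have h : ‖a‖ ≤ Real.sqrt ‖star a * a‖ := fullGroupNorm_le fun p => by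
    apply Real.le_sqrt_of_sq_le
    rw [← p.star_mul_self]
    exact le_fullGroupNorm p _
  calc ‖a‖ * ‖a‖ ≤ Real.sqrt ‖star a * a‖ * Real.sqrt ‖star a * a‖ :=
        mul_self_le_mul_self (norm_nonneg _) h
    _ = ‖star a * a‖ := Real.mul_self_sqrt (norm_nonneg _)

theorem groupAlgebra_norm_le_star (a : MonoidAlgebra ℂ G) : ‖a‖ ≤ ‖star a‖ := by
  have h := (groupAlgebra_norm_sq_le a).trans (norm_mul_le _ _)
  rcases (norm_nonneg a).eq_or_lt with h0 | h0
  · rw [← h0]; exact norm_nonneg _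
  · exact le_of_mul_le_mul_right h h0

instance instNormedStarGroupAlgebra : NormedStarGroup (MonoidAlgebra ℂ G) where
  norm_star_le a := by simpa using groupAlgebra_norm_le_star (star a)

end fullGroupNorm

/-- The full group C⋆-algebra `C⋆(G)` of a discrete group `G`: the (Hausdorff) completion of the
complex group algebra in the full C⋆-norm. -/
def GroupCStarAlgebra (G : Type*) [Group G] : Type _ :=
  UniformSpace.Completion (MonoidAlgebra ℂ G)

namespace GroupCStarAlgebra

open UniformSpace Completion

variable {G : Type*} [Group G]

noncomputable instance instNormedRing : NormedRing (GroupCStarAlgebra G) :=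
  inferInstanceAs (NormedRing (Completion (MonoidAlgebra ℂ G)))

noncomputable instance instAlgebra : Algebra ℂ (GroupCStarAlgebra G) :=
  inferInstanceAs (Algebra ℂ (Completion (MonoidAlgebra ℂ G)))

noncomputable instance instNormedAlgebra : NormedAlgebra ℂ (GroupCStarAlgebra G) where
  norm_smul_le c x := norm_smul_le (β := Completion (MonoidAlgebra ℂ G)) c x

instance instCompleteSpace : CompleteSpace (GroupCStarAlgebra G) :=
  inferInstanceAs (CompleteSpace (Completion (MonoidAlgebra ℂ G)))

/-- The canonical map `ℂ[G] → C⋆(G)`. -/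
noncomputable def ι (a : MonoidAlgebra ℂ G) : GroupCStarAlgebra G :=
  (a : Completion (MonoidAlgebra ℂ G))

theorem continuous_ι : Continuous (ι (G := G)) := Completion.continuous_coe _

theorem denseRange_ι : DenseRange (ι (G := G)) := Completion.denseRange_coe

theorem norm_ι (a : MonoidAlgebra ℂ G) : ‖ι a‖ = ‖a‖ := Completion.norm_coe a

theorem ι_add (a b : MonoidAlgebra ℂ G) : ι (a + b) = ι a + ι b := Completion.coe_add a b

theorem ι_mul (a b : MonoidAlgebra ℂ G) : ι (a * b) = ι a * ι b := Completion.coe_mul a b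

theorem ι_smul (c : ℂ) (a : MonoidAlgebra ℂ G) : ι (c • a) = c • ι a := Completion.coe_smul c a

/-- The involution of `C⋆(G)` is the continuous extension of that of `ℂ[G]`. -/
noncomputable instance instStar : Star (GroupCStarAlgebra G) where
  star := Completion.map (star : MonoidAlgebra ℂ G → MonoidAlgebra ℂ G)

theorem continuous_star' : Continuous (star : GroupCStarAlgebra G → GroupCStarAlgebra G) :=
  Completion.continuous_map

theorem star_ι (a : MonoidAlgebra ℂ G) : star (ι a) = ι (star a) :=
  Completion.map_coe
    (starNormedAddGroupHom : NormedAddGroupHom (MonoidAlgebra ℂ G) (MonoidAlgebra ℂ G)).uniformContinuous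
    a

noncomputable instance instStarRing : StarRing (GroupCStarAlgebra G) where
  star_involutive x := by
    refine denseRange_ι.induction_on x
      (isClosed_eq (continuous_star'.comp continuous_star') continuous_id) fun a => ?_
    rw [star_ι, star_ι, star_star]
  star_mul x y := by
    refine denseRange_ι.induction_on₂
      (p := fun x y : GroupCStarAlgebra G => star (x * y) = star y * star x)
      (isClosed_eq (continuous_star'.comp continuous_mul)
        ((continuous_star'.comp continuous_snd).mul (continuous_star'.comp continuous_fst)))
      (fun a b => ?_) x y
    rw [← ι_mul, star_ι, star_ι, star_ι, star_mul, ι_mul]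
  star_add x y := by
    refine denseRange_ι.induction_on₂
      (p := fun x y : GroupCStarAlgebra G => star (x + y) = star x + star y)
      (isClosed_eq (continuous_star'.comp continuous_add)
        ((continuous_star'.comp continuous_fst).add (continuous_star'.comp continuous_snd)))
      (fun a b => ?_) x y
    rw [← ι_add, star_ι, star_ι, star_ι, star_add, ι_add]

noncomputable instance instCStarAlgebra : CStarAlgebra (GroupCStarAlgebra G) where
  norm_mul_self_le x := by
    refine denseRange_ι.induction_on x
      (isClosed_le (continuous_norm.mul continuous_norm)
        (continuous_norm.comp (continuous_star'.mul continuous_id))) fun a => ?_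
    change ‖ι a‖ * ‖ι a‖ ≤ ‖star (ι a) * ι a‖
    rw [star_ι, ← ι_mul, norm_ι, norm_ι]
    exact groupAlgebra_norm_sq_le a
  star_smul c x := by
    refine denseRange_ι.induction_on x
      (isClosed_eq (continuous_star'.comp (continuous_const_smul c))
        (continuous_star'.const_smul (star c))) fun a => ?_
    rw [← ι_smul, star_ι, star_ι, star_smul, ι_smul]

end GroupCStarAlgebra

/-! ## Bounded rank -/

/-- An `m`-tuple of self-adjoint elements of a unital C⋆-algebra is `K`-unessential if for every
rational `δ > 0` it can be moved by at most `δ` to a self-adjoint tuple `z` such that `∑ z_k ^ 2` is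
invertible with an inverse of norm at most `1 / (K δ ^ 2)`. -/
def IsUnessential (K : ℝ) {X : Type*} [CStarAlgebra X] {m : ℕ} (y : Fin m → X) : Prop :=
  (∀ k, IsSelfAdjoint (y k)) ∧
    ∀ δ : ℚ, 0 < δ → ∃ z : Fin m → X, (∀ k, IsSelfAdjoint (z k)) ∧
      (∀ k, ‖y k - z k‖ ≤ (δ : ℝ)) ∧
      ∃ u : Xˣ, (u : X) = ∑ k, z k ^ 2 ∧ ‖((u⁻¹ : Xˣ) : X)‖ ≤ 1 / (K * (δ : ℝ) ^ 2)

/-- `br_K(X) ≤ n`: every `(n + 1)`-tuple of self-adjoint elements of `X` can be approximated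
arbitrarily well by `K`-unessential tuples. -/
def BoundedRankLE (K : ℝ) (n : ℕ) (X : Type*) [CStarAlgebra X] : Prop :=
  ∀ x : Fin (n + 1) → X, (∀ k, IsSelfAdjoint (x k)) → ∀ ε : ℝ, 0 < ε →
    ∃ y : Fin (n + 1) → X, IsUnessential K y ∧ ∀ k, ‖x k - y k‖ < ε

/-- The bounded rank `br_K(X)`: the least `n` with `br_K(X) ≤ n`, and `∞` if there is none. -/
noncomputable def boundedRank (K : ℝ) (X : Type*) [CStarAlgebra X] : ℕ∞ :=
  sInf {r : ℕ∞ | ∃ n : ℕ, r = n ∧ BoundedRankLE K n X}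

/-- The class of all separable unital C⋆-algebras with `br_K ≤ n`. -/
def IsSeparableOfBoundedRankLE (K : ℝ) (n : ℕ) (X : Type*) [CStarAlgebra X] : Prop :=
  TopologicalSpace.SeparableSpace X ∧ BoundedRankLE K n X

universe u

open TopologicalSpace
open scoped ENNReal

/-! Existence. Up to isomorphism a separable algebra lives on a set of real sequences
(`exists_starAlgEquiv_set`), so the ⋆-homomorphisms from `C⋆(𝔽_∞)` to nontrivial separable algebras
of bounded rank at most `n` can be indexed by one type. The `ℓ^∞`-product of all their codomains
again has bounded rank at most `n` (`BoundedRankLE.lp`), because the bound `1 / (K δ ^ 2)` on the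
inverses is the same in every factor. The product need not be separable, and the image of the
diagonal map need not have small bounded rank. A Löwenheim–Skolem argument
(`BoundedRankLE.exists_separable_subalgebra`) therefore encloses that image in a separable closed
subalgebra `Z` of the product with bounded rank at most `n`. Factoring a given homomorphism through
`Z` is then evaluation at one coordinate. Surjections onto every algebra of the class follow, since
a separable algebra is a quotient of `C⋆(𝔽_∞)`.

Exact value. Bounded rank does not increase under quotients, so it suffices to find one algebra of
the class that fails the bound for every `m < n`. Continuous functions on the Euclidean ball of
dimension `d = n + 1 - ⌈K⌉` serve. For the upper bound, a generic tuple of functions has at most `d`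
small entries at each point, and each other entry can be pushed to absolute value at least `δ`. For
the lower bound, the `d` coordinate functions cannot be perturbed slightly so as to lose their
common zero. This is a form of Brouwer's theorem, derived here from the absence of a `C¹` retraction
of a ball onto its sphere. -/

/-! ### The no-retraction theorem and stability of zeros. -/

theorem Matrix.det_one_add_smul_eq_eval {n : Type*} [Fintype n] [DecidableEq n]
    (M : Matrix n n ℝ) (t : ℝ) : (1 + t • M).det =
      (((Polynomial.X : Polynomial ℝ) • M.map Polynomial.C +
        (1 : Matrix n n ℝ).map Polynomial.C).det).eval t := by
  rw [← Polynomial.coe_evalRingHom, RingHom.map_det]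
  congr 1
  ext i j
  simp only [RingHom.mapMatrix_apply, Matrix.map_apply, Matrix.add_apply, Matrix.smul_apply,
    smul_eq_mul, Polynomial.coe_evalRingHom, Polynomial.eval_add, Polynomial.eval_mul,
    Polynomial.eval_X, Polynomial.eval_C]
  ring

/-- The degree bound is what matters: it lets the values at `dim E + 1` small parameters determine
all the others by interpolation. -/
theorem ContinuousLinearMap.exists_polynomial_det_one_add_smul {E : Type*} [NormedAddCommGroup E]
    [NormedSpace ℝ E] [FiniteDimensional ℝ E] (A : E →L[ℝ] E) :
    ∃ p : Polynomial ℝ, p.natDegree ≤ Module.finrank ℝ E ∧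
      ∀ t : ℝ, (1 + t • A : E →L[ℝ] E).det = p.eval t := by
  let b := Module.finBasis ℝ E
  let M := LinearMap.toMatrix b b (A : E →ₗ[ℝ] E)
  refine ⟨_, (Polynomial.natDegree_det_X_add_C_le M 1).trans (Fintype.card_fin _).le, fun t => ?_⟩
  rw [← Matrix.det_one_add_smul_eq_eval]
  have h2 : LinearMap.toMatrix b b (1 + t • (A : E →ₗ[ℝ] E)) = 1 + t • M := by
    rw [map_add, map_smul, LinearMap.toMatrix_one]
  rw [← h2, LinearMap.det_toMatrix]
  rfl

/-- If `x ↦ det (1 + t A(x))` has the same integral for all small `t ≥ 0`, then it has this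
integral for all `t`, as the integral is polynomial in `t`. -/
theorem MeasureTheory.setIntegral_det_one_add_smul_eq {E : Type*} [NormedAddCommGroup E]
    [NormedSpace ℝ E] [FiniteDimensional ℝ E] [MeasurableSpace E] {μ : Measure E} {s : Set E}
    (A : E → E →L[ℝ] E) (c t₀ : ℝ) (ht₀ : 0 < t₀)
    (hint : ∀ t ∈ Set.Icc 0 t₀, IntegrableOn (fun x => (1 + t • A x : E →L[ℝ] E).det) s μ)
    (h : ∀ t ∈ Set.Icc 0 t₀, ∫ x in s, (1 + t • A x : E →L[ℝ] E).det ∂μ = c) (u : ℝ) :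
    ∫ x in s, (1 + u • A x : E →L[ℝ] E).det ∂μ = c := by
  let d := Module.finrank ℝ E
  -- These are `d + 1` distinct nodes in `[0, t₀]`, enough for Lagrange interpolation of a
  -- polynomial of degree at most `d`.
  let v : ℕ → ℝ := fun j => t₀ * (j / (d + 1))
  have hd : (0 : ℝ) < d + 1 := by positivity
  have hv : Set.InjOn v (Finset.range (d + 1)) := by
    intro i _ j _ hij
    have h1 : (i : ℝ) / (d + 1) = j / (d + 1) := mul_left_cancel₀ ht₀.ne' hij
    have h2 : (i : ℝ) = j := by field_simp at h1; exact h1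
    exact_mod_cast h2
  have hmem : ∀ j ∈ Finset.range (d + 1), v j ∈ Set.Icc 0 t₀ := by
    intro j hj
    refine ⟨by positivity, ?_⟩
    have : (j : ℝ) / (d + 1) ≤ 1 := by
      rw [div_le_one hd]
      exact_mod_cast (Finset.mem_range.1 hj).le
    exact mul_le_of_le_one_right ht₀.le this
  have key : ∀ x, (1 + u • A x : E →L[ℝ] E).det = ∑ j ∈ Finset.range (d + 1),
      (Lagrange.basis (Finset.range (d + 1)) v j).eval u * (1 + v j • A x : E →L[ℝ] E).det := by
    intro x
    obtain ⟨p, hp, hpe⟩ := (A x).exists_polynomial_det_one_add_smul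
    have hdeg : p.degree < (Finset.range (d + 1)).card := by
      rw [Finset.card_range]
      exact Polynomial.degree_le_natDegree.trans_lt (by exact_mod_cast Nat.lt_succ_of_le hp)
    have := Lagrange.eq_interpolate hv hdeg
    rw [hpe u]
    conv_lhs => rw [this]
    rw [Lagrange.interpolate_apply, Polynomial.eval_finsetSum]
    refine Finset.sum_congr rfl fun j _ => ?_
    rw [Polynomial.eval_mul, Polynomial.eval_C, hpe, mul_comm]
  have hone : ∑ j ∈ Finset.range (d + 1),
      (Lagrange.basis (Finset.range (d + 1)) v j).eval u = 1 := by
    rw [← Polynomial.eval_finsetSum, Lagrange.sum_basis hv ⟨0, by simp⟩, Polynomial.eval_one]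
  simp_rw [key]
  rw [integral_finsetSum _ fun j hj => (hint _ (hmem j hj)).const_mul _]
  simp_rw [integral_const_mul]
  rw [Finset.sum_congr rfl fun j hj => by rw [h _ (hmem j hj)], ← Finset.sum_mul, hone, one_mul]

/-- By the Neumann series the determinant does not vanish along the path from `1` to `1 + t • A`. It
starts at `1`, so it stays positive by the intermediate value theorem. -/
theorem ContinuousLinearMap.det_one_add_smul_pos {E : Type*} [NormedAddCommGroup E]
    [NormedSpace ℝ E] [FiniteDimensional ℝ E] {A : E →L[ℝ] E} {t : ℝ} (ht : 0 ≤ t)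
    (hA : t * ‖A‖ < 1) : 0 < (1 + t • A : E →L[ℝ] E).det := by
  have hne : ∀ s ∈ Set.Icc 0 t, (1 + s • A : E →L[ℝ] E).det ≠ 0 := by
    intro s hs
    have hlt : ‖-(s • A)‖ < 1 := by
      rw [norm_neg, norm_smul, Real.norm_of_nonneg hs.1]
      exact (mul_le_mul_of_nonneg_right hs.2 (norm_nonneg _)).trans_lt hA
    have hu : IsUnit (1 + s • A : E →L[ℝ] E) := by
      simpa using isUnit_one_sub_of_norm_lt_one hlt
    have := hu.map (ContinuousLinearMap.toLinearMapRingHom : (E →L[ℝ] E) →+* E →ₗ[ℝ] E)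
    exact (LinearMap.isUnit_iff_isUnit_det _).1 this |>.ne_zero
  have hc : ContinuousOn (fun s : ℝ => (1 + s • A : E →L[ℝ] E).det) (Set.Icc 0 t) :=
    (ContinuousLinearMap.continuous_det.comp (by fun_prop)).continuousOn
  by_contra hcon
  have h1 : (1 + (0 : ℝ) • A : E →L[ℝ] E).det = 1 := by
    rw [zero_smul, add_zero]; exact LinearMap.det_id
  have := intermediate_value_Icc' ht hc
  obtain ⟨s, hs, hs0⟩ := this ⟨not_lt.1 hcon, by rw [h1]; exact zero_le_one⟩
  exact hne s hs hs0

open MeasureTheory Metric Set in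
/-- There is no `C¹` retraction of a closed ball onto its boundary sphere. -/
theorem no_contDiff_retraction {E : Type*} [NormedAddCommGroup E] [InnerProductSpace ℝ E]
    [FiniteDimensional ℝ E] {R : ℝ} (hR : 0 < R) (r : E → E) (hr : ContDiff ℝ 1 r)
    (hnorm : ∀ x, ‖r x‖ = R) (hid : ∀ x, ‖x‖ = R → r x = x) : False := by
  borelize E
  let μ : Measure E := volume
  let g : E → E := fun x => r x - x
  have hg : ContDiff ℝ 1 g := hr.sub contDiff_id
  have hgd : Differentiable ℝ g := hg.differentiable one_ne_zero
  have hgc : Continuous (fderiv ℝ g) := hg.continuous_fderiv one_ne_zero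
  obtain ⟨L, hL⟩ : ∃ L : ℝ, ∀ x ∈ closedBall (0 : E) R, ‖fderiv ℝ g x‖ ≤ L :=
    (isCompact_closedBall (0 : E) R).exists_bound_of_continuousOn hgc.continuousOn
  have hL0 : 0 ≤ L := (norm_nonneg _).trans (hL 0 (by simp [hR.le]))
  have hlip : ∀ x ∈ closedBall (0 : E) R, ∀ y ∈ closedBall (0 : E) R,
      ‖g x - g y‖ ≤ L * ‖x - y‖ := fun x hx y hy =>
    (convex_closedBall (0 : E) R).norm_image_sub_le_of_norm_fderiv_le
      (fun z _ => hgd z) hL hy hx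
  -- With this choice `t * (L + 1) ≤ 1 / 2` on `[0, t₀]`, which gives both `t * L < 1` and `t < 1`.
  set t₀ : ℝ := 1 / (2 * (L + 1)) with ht₀
  have ht₀pos : 0 < t₀ := by positivity
  have htL : ∀ t ∈ Icc 0 t₀, t * L < 1 ∧ t < 1 := by
    intro t ht
    have h1 : t * (L + 1) ≤ 1 / 2 := by
      calc t * (L + 1) ≤ t₀ * (L + 1) := by gcongr; exact ht.2
        _ = 1 / 2 := by rw [ht₀]; field_simp
    have := mul_nonneg ht.1 hL0
    constructor <;> nlinarith [ht.1]
  -- The straight-line homotopy `(1 - t) x + t r(x)` from the identity to the retraction.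
  let f : ℝ → E → E := fun t x => x + t • g x
  have hfd : ∀ t x, HasStrictFDerivAt (f t) (1 + t • fderiv ℝ g x : E →L[ℝ] E) x := fun t x =>
    (hasStrictFDerivAt_id x).add
      ((hg.contDiffAt.hasStrictFDerivAt one_ne_zero).const_smul t)
  have hdetc : ∀ t : ℝ, Continuous fun x => (1 + t • fderiv ℝ g x : E →L[ℝ] E).det := fun t =>
    ContinuousLinearMap.continuous_det.comp (by fun_prop)
  have hfc : ∀ t, Continuous (f t) := fun t => by
    have := hgd.continuous
    fun_prop
  have hpos : ∀ t ∈ Icc 0 t₀, ∀ x ∈ ball (0 : E) R, 0 < (1 + t • fderiv ℝ g x : E →L[ℝ] E).det :=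
    fun t ht x hx => ContinuousLinearMap.det_one_add_smul_pos ht.1
      ((mul_le_mul_of_nonneg_left (hL x (ball_subset_closedBall hx)) ht.1).trans_lt (htL t ht).1)
  have hinj : ∀ t ∈ Icc 0 t₀, InjOn (f t) (closedBall 0 R) := by
    intro t ht x hx y hy hxy
    have h1 : x - y = t • (g y - g x) := by
      have : x + t • g x = y + t • g y := hxy
      rw [smul_sub, sub_eq_sub_iff_add_eq_add, this, add_comm]
    have h2 : ‖x - y‖ ≤ t * L * ‖x - y‖ := by
      conv_lhs => rw [h1]
      rw [norm_smul, Real.norm_of_nonneg ht.1, mul_assoc]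
      refine mul_le_mul_of_nonneg_left ?_ ht.1
      rw [norm_sub_rev x y]
      exact hlip y hy x hx
    by_contra hne
    have h3 : 0 < ‖x - y‖ := norm_pos_iff.2 (sub_ne_zero.2 hne)
    nlinarith [(htL t ht).1]
  have hmaps : ∀ t ∈ Icc 0 t₀, ∀ x ∈ ball (0 : E) R, f t x ∈ ball (0 : E) R := by
    intro t ht x hx
    rw [mem_ball_zero_iff] at hx ⊢
    have h1 : f t x = (1 - t) • x + t • r x := by
      simp only [f, g, smul_sub, sub_smul, one_smul]; abel
    have h2 := (htL t ht).2
    calc ‖f t x‖ ≤ ‖(1 - t) • x‖ + ‖t • r x‖ := h1 ▸ norm_add_le _ _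
      _ = (1 - t) * ‖x‖ + t * R := by
        rw [norm_smul, norm_smul, hnorm, Real.norm_of_nonneg ht.1,
          Real.norm_of_nonneg (by linarith)]
      _ < R := by nlinarith
  -- The image is open by the inverse function theorem. It is relatively closed because the closed
  -- ball is compact and `f t` fixes the sphere. Connectedness of the open ball then gives equality.
  have himg : ∀ t ∈ Icc 0 t₀, f t '' ball 0 R = ball 0 R := by
    intro t ht
    have hsub : f t '' ball 0 R ⊆ ball 0 R := by
      rintro _ ⟨x, hx, rfl⟩; exact hmaps t ht x hx
    have hopen : IsOpen (f t '' ball 0 R) := by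
      rw [isOpen_iff_mem_nhds]
      rintro _ ⟨x, hx, rfl⟩
      have hu : ((1 + t • fderiv ℝ g x : E →L[ℝ] E)).det ≠ 0 := (hpos t ht x hx).ne'
      have hmap := HasStrictFDerivAt.map_nhds_eq_of_equiv
        (f' := (1 + t • fderiv ℝ g x : E →L[ℝ] E).toContinuousLinearEquivOfDetNeZero hu)
        (by simpa using hfd t x)
      rw [← hmap]
      exact Filter.image_mem_map (isOpen_ball.mem_nhds hx)
    have hclosed : f t '' ball 0 R = f t '' closedBall 0 R ∩ ball 0 R := by
      apply subset_antisymm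
      · exact subset_inter (image_mono ball_subset_closedBall) hsub
      · rintro _ ⟨⟨x, hx, rfl⟩, hx'⟩
        refine ⟨x, ?_, rfl⟩
        rw [mem_closedBall_zero_iff] at hx
        rw [mem_ball_zero_iff]
        refine lt_of_le_of_ne hx fun heq => ?_
        have : f t x = x := by simp [f, g, hid x heq]
        rw [this, mem_ball_zero_iff, heq] at hx'
        exact lt_irrefl _ hx'
    have hcl : IsClosed (f t '' closedBall 0 R) :=
      ((isCompact_closedBall (0 : E) R).image (hfc t)).isClosed
    refine subset_antisymm hsub ?_
    have hpre : IsPreconnected (ball (0 : E) R) := (convex_ball (0 : E) R).isPreconnected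
    by_contra hnot
    obtain ⟨y, hy, hy'⟩ := not_subset.1 hnot
    have hcover : ball (0 : E) R ⊆ f t '' ball 0 R ∪ (f t '' closedBall 0 R)ᶜ := by
      intro z hz
      by_cases hz' : z ∈ f t '' closedBall 0 R
      · exact Or.inl (hclosed ▸ ⟨hz', hz⟩)
      · exact Or.inr hz'
    obtain ⟨z, -, hz1, hz2⟩ := hpre _ _ hopen hcl.isOpen_compl hcover
      ⟨f t 0, hmaps t ht 0 (by simpa using hR), mem_image_of_mem _ (by simpa using hR)⟩
      ⟨y, hy, fun h => hy' (hclosed ▸ ⟨h, hy⟩)⟩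
    exact hz2 (image_mono ball_subset_closedBall hz1)
  have hint : ∀ t : ℝ,
      IntegrableOn (fun x => (1 + t • fderiv ℝ g x : E →L[ℝ] E).det) (ball 0 R) μ := fun t =>
    ((hdetc t).continuousOn.integrableOn_compact (isCompact_closedBall (0 : E) R)).mono_set
      ball_subset_closedBall
  have hvol : ∀ t ∈ Icc 0 t₀, ∫ x in ball (0 : E) R, (1 + t • fderiv ℝ g x : E →L[ℝ] E).det ∂μ =
      μ.real (ball 0 R) := by
    intro t ht
    have h1 := integral_image_eq_integral_abs_det_fderiv_smul μ (measurableSet_ball (x := (0 : E)))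
      (fun x _ => (hfd t x).hasFDerivAt.hasFDerivWithinAt)
      ((hinj t ht).mono ball_subset_closedBall) (fun _ => (1 : ℝ))
    rw [himg t ht] at h1
    simp only [integral_const, smul_eq_mul, mul_one, measureReal_restrict_apply MeasurableSet.univ,
      univ_inter] at h1
    rw [h1]
    exact setIntegral_congr_fun measurableSet_ball fun x hx => (abs_of_pos (hpos t ht x hx)).symm
  -- For small `t` the integral of the Jacobian is the volume of the ball, by change of variables.
  -- Extrapolating to `t = 1` gives the same value for the integral of `det Dr`.
  have hfin := setIntegral_det_one_add_smul_eq (μ := μ) (s := ball (0 : E) R)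
    (fun x => fderiv ℝ g x) _ t₀ ht₀pos (fun t _ => hint t) hvol 1
  -- Since `‖r‖` is constant, the range of `Dr(x)` is orthogonal to the nonzero vector `r x`, so
  -- `Dr(x)` is not surjective.
  have hzero : ∀ x, (1 + (1 : ℝ) • fderiv ℝ g x : E →L[ℝ] E).det = 0 := by
    intro x
    have hrd : DifferentiableAt ℝ r x := hr.differentiable one_ne_zero x
    have h1 : (1 + (1 : ℝ) • fderiv ℝ g x : E →L[ℝ] E) = fderiv ℝ r x := by
      have : fderiv ℝ g x = fderiv ℝ r x - 1 := by
        rw [show g = r - id from rfl, fderiv_sub hrd differentiableAt_id, fderiv_id]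
        rfl
      rw [this, one_smul, add_sub_cancel]
    rw [h1]
    by_contra hdet
    have hsurj : Function.Surjective (fderiv ℝ r x) :=
      ((fderiv ℝ r x).toContinuousLinearEquivOfDetNeZero hdet).surjective
    obtain ⟨v, hv⟩ := hsurj (r x)
    have hconst : (fun y => inner ℝ (r y) (r y)) = fun _ => R ^ 2 := by
      ext y; rw [real_inner_self_eq_norm_sq, hnorm]
    have hder := (hrd.hasFDerivAt.inner ℝ hrd.hasFDerivAt)
    rw [hconst] at hder
    have h0 := congrArg (fun φ => φ v) (hder.unique (hasFDerivAt_const (R ^ 2) x))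
    simp only [ContinuousLinearMap.coe_comp, Function.comp_apply, ContinuousLinearMap.prod_apply,
      fderivInnerCLM_apply, hv, zero_apply] at h0
    rw [real_inner_self_eq_norm_sq, hnorm] at h0
    nlinarith
  simp only [hzero, integral_zero] at hfin
  have hne : μ.real (ball (0 : E) R) ≠ 0 := by
    rw [measureReal_def]
    exact (ENNReal.toReal_pos (measure_ball_pos μ 0 hR).ne' measure_ball_lt_top.ne).ne'
  exact hne hfin.symm

open Metric Set in
/-- A continuous perturbation by less than `1` of the inclusion of the unit ball of a Euclidean
space has a zero. -/
theorem exists_zero_of_norm_sub_le {E : Type*} [NormedAddCommGroup E] [InnerProductSpace ℝ E]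
    [FiniteDimensional ℝ E] {c : ℝ} (hc : c < 1) (z : closedBall (0 : E) 1 → E)
    (hz : Continuous z) (hclose : ∀ x, ‖z x - x‖ ≤ c) : ∃ x, z x = 0 := by
  by_contra! hne
  let ρ : E → E := fun x => (max 1 ‖x‖)⁻¹ • x
  have hmax : ∀ x : E, 0 < max 1 ‖x‖ := fun x => lt_max_of_lt_left one_pos
  have hρ : Continuous ρ :=
    ((continuous_const.max continuous_norm).inv₀ fun x => (hmax x).ne').smul continuous_id
  have hρb : ∀ x, ρ x ∈ closedBall (0 : E) 1 := fun x => by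
    rw [mem_closedBall_zero_iff, norm_smul, norm_inv, Real.norm_of_nonneg (hmax x).le,
      inv_mul_le_one₀ (hmax x)]
    exact le_max_right _ _
  have hρid : ∀ x, ‖x‖ ≤ 1 → ρ x = x := fun x hx => by simp [ρ, max_eq_left hx]
  let p : E → closedBall (0 : E) 1 := fun x => ⟨ρ x, hρb x⟩
  let τ : E → ℝ := fun x => max 0 (min 1 (2 - ‖x‖))
  have hτ0 : ∀ x, 0 ≤ τ x := fun x => le_max_left _ _
  have hτ1 : ∀ x, τ x ≤ 1 := fun x => max_le zero_le_one (min_le_left _ _)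
  -- Extends `z` to all of `E`. The map `ρ` is the radial projection onto the unit ball, and the
  -- cutoff `τ` makes `w` equal to `z` on that ball and to the identity beyond radius `2`. In
  -- between, the perturbation has norm at most `c < 1 < ‖x‖`, so `w` acquires no zero.
  let w : E → E := fun x => x + τ x • (z (p x) - ρ x)
  have hw : Continuous w := by
    have h1 : Continuous p := hρ.subtype_mk _
    have h2 : Continuous τ := by fun_prop
    exact continuous_id.add (h2.smul ((hz.comp h1).sub hρ))
  have hwne : ∀ x, w x ≠ 0 := by
    intro x hx
    rcases le_or_gt ‖x‖ 1 with h | h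
    · have h1 : τ x = 1 := by
        simp only [τ]
        rw [min_eq_left (by linarith), max_eq_right zero_le_one]
      simp only [w, h1, one_smul, hρid x h, add_sub_cancel] at hx
      exact hne _ hx
    · have h2 : x = -(τ x • (z (p x) - ρ x)) := eq_neg_of_add_eq_zero_left hx
      have h3 : ‖x‖ ≤ 1 * ‖z (p x) - ρ x‖ := by
        conv_lhs => rw [h2]
        rw [norm_neg, norm_smul, Real.norm_of_nonneg (hτ0 x)]
        exact mul_le_mul_of_nonneg_right (hτ1 x) (norm_nonneg _)
      have h4 := hclose (p x)
      simp only [p] at h4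
      simp only [p] at h3
      linarith
  have hwid : ∀ x, 2 < ‖x‖ → w x = x := by
    intro x hx
    have : τ x = 0 := max_eq_left ((min_le_right _ _).trans (by linarith))
    simp [w, this]
  -- The tolerance `‖w x‖` keeps `g` free of zeros, and `g` is the identity from radius `3` on.
  -- Hence `3 g / ‖g‖` is a forbidden `C¹` retraction of the ball of radius `3`.
  obtain ⟨g, hg, hgw, hgeq, -⟩ := hw.exists_contDiff_approx_and_eqOn (n := 1)
    (ε := fun x => ‖w x‖) hw.norm (fun x => norm_pos_iff.2 (hwne x))
    (S := {x : E | 3 ≤ ‖x‖}) (U := {x : E | 2 < ‖x‖})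
    (isClosed_le continuous_const continuous_norm)
    ((isOpen_lt continuous_const continuous_norm).mem_nhdsSet.2 fun x (hx : 3 ≤ ‖x‖) =>
      show 2 < ‖x‖ by linarith)
    (contDiff_id.contDiffOn.congr fun x hx => hwid x hx)
  have hgne : ∀ x, g x ≠ 0 := by
    intro x hx
    have := hgw x
    rw [hx, dist_zero_left] at this
    exact lt_irrefl _ this
  refine no_contDiff_retraction (E := E) (R := 3) (by norm_num)
    (fun x => (3 / ‖g x‖) • g x) ?_ ?_ ?_
  · exact (contDiff_const.div (hg.norm ℝ hgne) fun x => norm_ne_zero_iff.2 (hgne x)).smul hg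
  · intro x
    have := norm_ne_zero_iff.2 (hgne x)
    rw [norm_smul, norm_div, norm_norm, div_mul_cancel₀ _ this]
    norm_num
  · intro x hx
    have h1 : g x = x := (hgeq (show (3 : ℝ) ≤ ‖x‖ from hx.ge)).trans (hwid x (by rw [hx]; norm_num))
    simp only [h1, hx]
    norm_num

/-! ### Bounded rank of the algebra of continuous functions on a ball. -/

open Metric Set in
/-- Generically, a tuple of continuous functions on a `d`-dimensional ball has at most `d` common
zeros at each point, uniformly. -/
theorem exists_approx_card_abs_lt_le {E : Type*} [NormedAddCommGroup E]
    [InnerProductSpace ℝ E] [FiniteDimensional ℝ E] {N : ℕ}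
    (f : closedBall (0 : E) 1 → Fin N → ℝ) (hf : Continuous f) {ε : ℝ} (hε : 0 < ε) :
    ∃ y : closedBall (0 : E) 1 → Fin N → ℝ, Continuous y ∧ (∀ x, ‖f x - y x‖ < ε) ∧
      ∃ η > 0, ∀ x, (Finset.univ.filter fun i => |y x i| < η).card ≤ Module.finrank ℝ E := by
  let d := Module.finrank ℝ E
  obtain ⟨F, hF⟩ := ContinuousMap.exists_restrict_eq (isClosed_closedBall (x := (0 : E)) (ε := 1))
    (⟨f, hf⟩ : C(closedBall (0 : E) 1, Fin N → ℝ))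
  obtain ⟨g, hg, hgF, -⟩ := F.continuous.exists_contDiff_approx (n := 1)
    (ε := fun _ => ε / 2) continuous_const (fun _ => half_pos hε)
  -- `P e` selects `d + 1` coordinates. A `C¹` image of a `d`-dimensional space has dense complement
  -- in `d + 1` dimensions, so an arbitrarily small translation `c` avoids all these images at once.
  -- Then no `d + 1` entries of `g - c` vanish together on the ball.
  let P : (Fin (d + 1) ↪ Fin N) → (Fin N → ℝ) →L[ℝ] (Fin (d + 1) → ℝ) := fun e =>
    ContinuousLinearMap.pi fun j => ContinuousLinearMap.proj (e j)
  have hP : ∀ e, IsOpenMap (P e) := fun e => (P e).isOpenMap fun v => by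
    refine ⟨Function.extend e v 0, ?_⟩
    ext j
    exact e.injective.extend_apply _ _ _
  have hPg : ∀ e, ContDiff ℝ 1 fun x => P e (g x) := fun e => (P e).contDiff.comp hg
  let U : (Fin (d + 1) ↪ Fin N) → Set (Fin N → ℝ) := fun e =>
    P e ⁻¹' ((fun x => P e (g x)) '' closedBall 0 1)ᶜ
  have hUo : ∀ e, IsOpen (U e) := fun e =>
    (((isCompact_closedBall (0 : E) 1).image (hPg e).continuous).isClosed.isOpen_compl).preimage
      (P e).continuous
  have hUd : ∀ e, Dense (U e) := fun e => by
    refine Dense.preimage ?_ (hP e)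
    refine ((hPg e).dense_compl_range_of_finrank_lt_finrank (by simp [d])).mono ?_
    exact compl_subset_compl.2 (image_subset_range _ _)
  obtain ⟨c, hcU, hc⟩ := (dense_iInter_of_isOpen hUo hUd).exists_dist_lt 0 (half_pos hε)
  rw [dist_zero_left] at hc
  have hyc : Continuous fun x : closedBall (0 : E) 1 => g x - c :=
    (hg.continuous.comp continuous_subtype_val).sub continuous_const
  -- Compactness turns the absence of common zeros into a uniform lower bound.
  have hη : ∀ e : Fin (d + 1) ↪ Fin N, ∃ η > 0, ∀ x : closedBall (0 : E) 1,
      η ≤ ‖P e (g x - c)‖ := by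
    intro e
    have hcont : Continuous fun x : closedBall (0 : E) 1 => ‖P e (g x - c)‖ :=
      ((P e).continuous.comp hyc).norm
    have : CompactSpace (closedBall (0 : E) 1) :=
      isCompact_iff_compactSpace.1 (isCompact_closedBall _ _)
    have : Nonempty (closedBall (0 : E) 1) := ⟨⟨0, by simp⟩⟩
    obtain ⟨x₀, -, hx₀⟩ := isCompact_univ.exists_isMinOn univ_nonempty hcont.continuousOn
    refine ⟨_, norm_pos_iff.2 ?_, fun x => hx₀ (mem_univ x)⟩
    intro h0
    rw [map_sub, sub_eq_zero] at h0
    exact mem_iInter.1 hcU e ⟨x₀, x₀.2, h0⟩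
  choose η hη0 hη using hη
  obtain ⟨η', hη'0, hη'⟩ : ∃ η' > 0, ∀ e, η' ≤ η e := by
    rcases isEmpty_or_nonempty (Fin (d + 1) ↪ Fin N) with h | h
    · exact ⟨1, one_pos, fun e => h.elim e⟩
    · obtain ⟨e₀, he₀⟩ := Finite.exists_min η
      exact ⟨η e₀, hη0 e₀, he₀⟩
  refine ⟨fun x => g x - c, hyc, fun x => ?_, η', hη'0, fun x => ?_⟩
  · have h1 : F x = f x := congrArg (fun φ => φ x) hF
    have h2 := hgF x
    rw [dist_eq_norm, norm_sub_rev, h1] at h2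
    calc ‖f x - (g x - c)‖ = ‖(f x - g x) + c‖ := by congr 1; abel
      _ ≤ ‖f x - g x‖ + ‖c‖ := norm_add_le _ _
      _ < ε := by linarith
  · by_contra! hcard
    obtain ⟨T, hT, hTc⟩ := Finset.exists_subset_card_eq (Nat.succ_le_of_lt hcard)
    let e : Fin (d + 1) ↪ Fin N := (T.orderEmbOfFin hTc).toEmbedding
    have h1 : ‖P e (g x - c)‖ < η' := by
      rw [pi_norm_lt_iff hη'0]
      intro j
      exact (Finset.mem_filter.1 (hT (T.orderEmbOfFin_mem hTc j))).2
    exact absurd ((hη' e).trans (hη e x)) (not_le.2 h1)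

theorem ContinuousMap.isSelfAdjoint_iff_im {B : Type*} [TopologicalSpace B] [CompactSpace B]
    (x : C(B, ℂ)) : IsSelfAdjoint x ↔ ∀ b, (x b).im = 0 := by
  rw [IsSelfAdjoint, ContinuousMap.ext_iff]
  exact forall_congr' fun b => Complex.conj_eq_iff_im

/-- Moving each `t` by `δ` away from the origin, continuously. -/
noncomputable def pushAway (η δ t : ℝ) : ℝ := t + δ * max (-1) (min 1 (t / η))

theorem continuous_pushAway (η δ : ℝ) : Continuous (pushAway η δ) := by
  unfold pushAway; fun_prop

theorem abs_sub_pushAway_le {η δ : ℝ} (hδ : 0 ≤ δ) (t : ℝ) : |t - pushAway η δ t| ≤ δ := by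
  have : |max (-1) (min 1 (t / η))| ≤ 1 :=
    abs_le.2 ⟨le_max_left _ _, max_le (by norm_num) (min_le_left _ _)⟩
  rw [pushAway, sub_add_cancel_left, abs_neg, abs_mul, abs_of_nonneg hδ]
  exact mul_le_of_le_one_right hδ this

theorem le_abs_pushAway {η δ : ℝ} (hη : 0 < η) {t : ℝ} (ht : η ≤ |t|) :
    δ ≤ |pushAway η δ t| := by
  rcases le_total 0 t with h | h
  · rw [abs_of_nonneg h] at ht
    have : pushAway η δ t = t + δ := by
      rw [pushAway, min_eq_left ((one_le_div hη).2 ht), max_eq_right (by norm_num), mul_one]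
    rw [this]
    exact le_trans (by linarith) (le_abs_self _)
  · rw [abs_of_nonpos h] at ht
    have h1 : t / η ≤ -1 := by rw [div_le_iff₀ hη]; linarith
    have : pushAway η δ t = t - δ := by
      rw [pushAway, min_eq_right (by linarith), max_eq_left h1]; ring
    rw [this]
    exact le_trans (by linarith) (neg_le_abs _)

open Metric in
-- After a generic perturbation at least `n + 1 - dim E ≥ K` entries have absolute value at least
-- `η` at each point. Pushing those out by `δ` makes the sum of squares at least `K δ ^ 2`. The
-- threshold `η` does not depend on `δ`, so one perturbed tuple serves every `δ`.
theorem boundedRankLE_continuousMap_closedBall {E : Type*} [NormedAddCommGroup E]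
    [InnerProductSpace ℝ E] [FiniteDimensional ℝ E] [CompactSpace (closedBall (0 : E) 1)]
    {K : ℝ} (hK : 0 < K) {n : ℕ} (hKn : K + Module.finrank ℝ E ≤ n + 1) :
    BoundedRankLE K n C(closedBall (0 : E) 1, ℂ) := by
  intro x hx ε hε
  obtain ⟨y, hyc, hxy, η, hη, hcard⟩ := exists_approx_card_abs_lt_le
    (fun b i => (x i b).re) (continuous_pi fun i => Complex.continuous_re.comp (x i).continuous) hε
  have hyi : ∀ i, Continuous fun b => y b i := fun i => (continuous_apply i).comp hyc
  refine ⟨fun i => ⟨fun b => (y b i : ℂ), Complex.continuous_ofReal.comp (hyi i)⟩, ⟨?_, ?_⟩, ?_⟩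
  · intro i
    rw [ContinuousMap.isSelfAdjoint_iff_im]
    exact fun b => Complex.ofReal_im _
  · intro δ hδ
    have hδ' : (0 : ℝ) < δ := by exact_mod_cast hδ
    let w : closedBall (0 : E) 1 → ℝ := fun b => ∑ i, pushAway η δ (y b i) ^ 2
    have hwc : Continuous w := continuous_finsetSum _ fun i _ =>
      ((continuous_pushAway η δ).comp (hyi i)).pow 2
    have hw : ∀ b, K * δ ^ 2 ≤ w b := by
      intro b
      have h1 : (n + 1 : ℝ) - Module.finrank ℝ E ≤
          (Finset.univ.filter fun i => ¬ |y b i| < η).card := by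
        have h2 := Finset.card_filter_add_card_filter_not (s := (Finset.univ : Finset (Fin (n + 1))))
          (fun i => |y b i| < η)
        rw [Finset.card_univ, Fintype.card_fin] at h2
        have h3 : ((Finset.univ.filter fun i => |y b i| < η).card : ℝ) ≤ Module.finrank ℝ E := by
          exact_mod_cast hcard b
        have h4 : ((Finset.univ.filter fun i => |y b i| < η).card : ℝ) +
          (Finset.univ.filter fun i => ¬ |y b i| < η).card = n + 1 := by exact_mod_cast h2
        linarith
      calc K * (δ : ℝ) ^ 2 ≤ (Finset.univ.filter fun i => ¬ |y b i| < η).card * (δ : ℝ) ^ 2 := by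
            gcongr; linarith
        _ = ∑ i ∈ Finset.univ.filter fun i => ¬ |y b i| < η, (δ : ℝ) ^ 2 := by
            rw [Finset.sum_const, nsmul_eq_mul]
        _ ≤ ∑ i ∈ Finset.univ.filter fun i => ¬ |y b i| < η, pushAway η δ (y b i) ^ 2 := by
            refine Finset.sum_le_sum fun i hi => ?_
            rw [← sq_abs (pushAway _ _ _)]
            exact pow_le_pow_left₀ hδ'.le
              (le_abs_pushAway hη (not_lt.1 (Finset.mem_filter.1 hi).2)) 2
        _ ≤ w b := Finset.sum_le_sum_of_subset_of_nonneg (Finset.filter_subset _ _)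
            fun _ _ _ => sq_nonneg _
    have hKδ : 0 < K * (δ : ℝ) ^ 2 := by positivity
    have hwpos : ∀ b, 0 < w b := fun b => hKδ.trans_le (hw b)
    refine ⟨fun i => ⟨fun b => (pushAway η δ (y b i) : ℂ),
      Complex.continuous_ofReal.comp ((continuous_pushAway η δ).comp (hyi i))⟩, ?_, ?_, ?_⟩
    · intro i
      rw [ContinuousMap.isSelfAdjoint_iff_im]
      exact fun b => Complex.ofReal_im _
    · intro i
      rw [ContinuousMap.norm_le _ hδ'.le]
      intro b
      change ‖(y b i : ℂ) - (pushAway η δ (y b i) : ℂ)‖ ≤ δ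
      rw [← Complex.ofReal_sub, Complex.norm_real]
      exact abs_sub_pushAway_le hδ'.le _
    · let W : C(closedBall (0 : E) 1, ℂ) := ⟨fun b => (w b : ℂ), Complex.continuous_ofReal.comp hwc⟩
      let V : C(closedBall (0 : E) 1, ℂ) := ⟨fun b => ((w b)⁻¹ : ℝ),
        Complex.continuous_ofReal.comp (hwc.inv₀ fun b => (hwpos b).ne')⟩
      have hWV : W * V = 1 := by
        ext b
        change (w b : ℂ) * ((w b)⁻¹ : ℝ) = 1
        rw [← Complex.ofReal_mul, mul_inv_cancel₀ (hwpos b).ne', Complex.ofReal_one]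
      refine ⟨⟨W, V, hWV, by rw [mul_comm, hWV]⟩, ?_, ?_⟩
      · ext b
        simp [W, w]
      · change ‖V‖ ≤ _
        rw [ContinuousMap.norm_le _ (by positivity)]
        intro b
        change ‖(((w b)⁻¹ : ℝ) : ℂ)‖ ≤ _
        rw [Complex.norm_real, Real.norm_of_nonneg (inv_nonneg.2 (hwpos b).le), ← one_div]
        exact one_div_le_one_div_of_le hKδ (hw b)
  · intro i
    rw [ContinuousMap.norm_lt_iff _ hε]
    intro b
    have h1 : x i b = ((x i b).re : ℂ) :=
      Complex.ext rfl (by simpa using (ContinuousMap.isSelfAdjoint_iff_im _).1 (hx i) b)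
    change ‖x i b - (y b i : ℂ)‖ < ε
    rw [h1, ← Complex.ofReal_sub, Complex.norm_real]
    exact (norm_le_pi_norm ((fun i => (x i b).re) - y b) i).trans_lt (hxy b)

theorem Fin.card_filter_le_val_le (N d : ℕ) :
    (Finset.univ.filter fun i : Fin N => ¬ (i : ℕ) < d).card ≤ N - d := by
  rw [← Nat.card_Ico]
  refine Finset.card_le_card_of_injOn (fun i => (i : ℕ)) ?_ (Fin.val_injective.injOn)
  intro i hi
  have := (Finset.mem_filter.1 hi).2
  exact Finset.mem_coe.2 (Finset.mem_Ico.2 ⟨not_lt.1 this, i.2⟩)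

open Metric in
-- The test tuple consists of the coordinate functions, padded by zeros. Any nearby tuple has a
-- point where its entries of index below `d` vanish. There at most `m + 1 - d` entries remain, each
-- of size at most `δ + ε`, so the sum of squares falls below `K δ ^ 2`.
theorem not_boundedRankLE_continuousMap_closedBall {d m : ℕ}
    [CompactSpace (closedBall (0 : EuclideanSpace ℝ (Fin d)) 1)] {K : ℝ}
    (hK : ((m + 1 - d : ℕ) : ℝ) < K) :
    ¬ BoundedRankLE K m C(closedBall (0 : EuclideanSpace ℝ (Fin d)) 1, ℂ) := by
  intro hbr
  let B := closedBall (0 : EuclideanSpace ℝ (Fin d)) 1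
  have hK0 : 0 < K := (Nat.cast_nonneg _).trans_lt hK
  -- Chosen so that `d * (2 * δ) ^ 2 ≤ 1 / 4`: entrywise errors of at most `2 * δ` then give a
  -- Euclidean error of at most `1 / 2`.
  let δ : ℚ := 1 / (4 * (d + 1))
  have hδ : 0 < δ := by positivity
  have hδ' : (0 : ℝ) < δ := by exact_mod_cast hδ
  obtain ⟨ε, hε, hεδ, hεK⟩ : ∃ ε : ℝ, 0 < ε ∧ ε ≤ δ ∧
      ((m + 1 - d : ℕ) : ℝ) * (δ + ε) ^ 2 < K * (δ : ℝ) ^ 2 := by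
    have hcont : Continuous fun ε : ℝ => ((m + 1 - d : ℕ) : ℝ) * (δ + ε) ^ 2 := by fun_prop
    have h0 : ((m + 1 - d : ℕ) : ℝ) * (δ + 0) ^ 2 < K * (δ : ℝ) ^ 2 := by
      rw [add_zero]; gcongr
    have h1 := (hcont.tendsto 0).eventually_lt_const h0
    obtain ⟨r, hr, hr'⟩ := Metric.eventually_nhds_iff.1 h1
    refine ⟨min (r / 2) δ, lt_min (half_pos hr) hδ', min_le_right _ _, hr' ?_⟩
    rw [dist_zero_right, Real.norm_of_nonneg (le_min (half_pos hr).le hδ'.le)]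
    exact (min_le_left _ _).trans_lt (half_lt_self hr)
  let x : Fin (m + 1) → C(B, ℂ) := fun i =>
    ⟨fun b => ((if h : (i : ℕ) < d then b.1 ⟨i, h⟩ else 0 : ℝ) : ℂ), by
      refine Complex.continuous_ofReal.comp ?_
      split_ifs with h
      · fun_prop
      · exact continuous_const⟩
  obtain ⟨y, ⟨-, hy⟩, hxy⟩ := hbr x
    (fun i => (ContinuousMap.isSelfAdjoint_iff_im _).2 fun b => Complex.ofReal_im _) ε hε
  obtain ⟨z, hz, hyz, u, hu, hu'⟩ := hy δ hδ
  have hzx : ∀ i (b : B), |(z i b).re - (if h : (i : ℕ) < d then b.1 ⟨i, h⟩ else 0 : ℝ)| ≤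
      δ + ε := by
    intro i b
    calc |(z i b).re - (if h : (i : ℕ) < d then b.1 ⟨i, h⟩ else 0 : ℝ)| = |(z i b - x i b).re| := by
          simp [x]
      _ ≤ ‖(z i - x i) b‖ := Complex.abs_re_le_norm _
      _ ≤ ‖z i - x i‖ := ContinuousMap.norm_coe_le_norm _ _
      _ = ‖(y i - z i) + (x i - y i)‖ := by rw [norm_sub_rev]; congr 1; abel
      _ ≤ δ + ε := (norm_add_le _ _).trans (add_le_add (hyz i) (hxy i).le)
  -- If `d > m + 1`, the tuple has too few entries. The missing ones are filled with the unperturbed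
  -- coordinates, and the truncated difference `m + 1 - d` is `0`.
  let ζ : B → EuclideanSpace ℝ (Fin d) := fun b => WithLp.toLp 2 fun i =>
    if h : (i : ℕ) < m + 1 then (z ⟨i, h⟩ b).re else b.1 i
  have hζ : Continuous ζ := by
    refine (PiLp.continuous_toLp 2 _).comp (continuous_pi fun i => ?_)
    split_ifs with h
    · exact Complex.continuous_re.comp (z _).continuous
    · fun_prop
  obtain ⟨b, hb⟩ := exists_zero_of_norm_sub_le (c := 1 / 2) (by norm_num) ζ hζ fun b => by
    rw [← sq_le_sq₀ (norm_nonneg _) (by norm_num), EuclideanSpace.real_norm_sq_eq]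
    have h1 : ∀ i, (ζ b - b.1) i ^ 2 ≤ (2 * (δ : ℝ)) ^ 2 := by
      intro i
      rw [← sq_abs]
      refine pow_le_pow_left₀ (abs_nonneg _) ?_ 2
      by_cases h : (i : ℕ) < m + 1
      · have := hzx ⟨i, h⟩ b
        simp only [i.2, dif_pos] at this
        simp only [ζ, PiLp.sub_apply, h, dif_pos]
        exact this.trans (by linarith)
      · simp only [ζ, PiLp.sub_apply, h, dif_neg, not_false_eq_true, sub_self, abs_zero]
        positivity
    refine (Finset.sum_le_sum fun i _ => h1 i).trans ?_
    rw [Finset.sum_const, Finset.card_univ, Fintype.card_fin, nsmul_eq_mul]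
    have hδe : (δ : ℝ) = 1 / (4 * (d + 1)) := by simp [δ]
    have hd : (0 : ℝ) ≤ d := Nat.cast_nonneg d
    rw [hδe, mul_pow, div_pow, ← mul_assoc, one_pow, mul_one_div, div_le_iff₀ (by positivity)]
    nlinarith
  have hzero : ∀ i : Fin (m + 1), (i : ℕ) < d → (z i b).re = 0 := by
    intro i hi
    have := congrArg (fun v : EuclideanSpace ℝ (Fin d) => v ⟨i, hi⟩) hb
    simpa [ζ, i.2] using this
  have hsum : ∑ i, (z i b).re ^ 2 ≤ ((m + 1 - d : ℕ) : ℝ) * (δ + ε) ^ 2 := by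
    calc ∑ i, (z i b).re ^ 2 = ∑ i ∈ Finset.univ.filter fun i : Fin (m + 1) => ¬ (i : ℕ) < d,
          (z i b).re ^ 2 := by
          refine (Finset.sum_filter_of_ne fun i _ hi => ?_).symm
          contrapose! hi
          rw [hzero i hi]; norm_num
      _ ≤ ∑ i ∈ Finset.univ.filter fun i : Fin (m + 1) => ¬ (i : ℕ) < d, (δ + ε) ^ 2 := by
          refine Finset.sum_le_sum fun i hi => ?_
          rw [← sq_abs]
          refine pow_le_pow_left₀ (abs_nonneg _) ?_ 2
          have := hzx i b
          simpa only [(Finset.mem_filter.1 hi).2, dif_neg, not_false_eq_true, sub_zero] using this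
      _ = (Finset.univ.filter fun i : Fin (m + 1) => ¬ (i : ℕ) < d).card * (δ + ε) ^ 2 := by
          rw [Finset.sum_const, nsmul_eq_mul]
      _ ≤ _ := by
          gcongr
          exact Fin.card_filter_le_val_le _ _
  have hub : (u : C(B, ℂ)) b = ((∑ i, (z i b).re ^ 2 : ℝ) : ℂ) := by
    rw [hu]
    simp only [ContinuousMap.sum_apply, ContinuousMap.pow_apply, Complex.ofReal_sum,
      Complex.ofReal_pow]
    refine Finset.sum_congr rfl fun i _ => ?_
    congr 1
    exact Complex.ext rfl (by simpa using (ContinuousMap.isSelfAdjoint_iff_im _).1 (hz i) b)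
  have hone : ((u⁻¹ : C(B, ℂ)ˣ) : C(B, ℂ)) b * (u : C(B, ℂ)) b = 1 := by
    rw [← ContinuousMap.mul_apply, Units.inv_mul, ContinuousMap.one_apply]
  have hS : 0 ≤ ∑ i, (z i b).re ^ 2 := Finset.sum_nonneg fun _ _ => sq_nonneg _
  have h2 : 1 ≤ 1 / (K * (δ : ℝ) ^ 2) * ∑ i, (z i b).re ^ 2 := by
    calc (1 : ℝ) = ‖((u⁻¹ : C(B, ℂ)ˣ) : C(B, ℂ)) b * (u : C(B, ℂ)) b‖ := by rw [hone, norm_one]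
      _ = ‖((u⁻¹ : C(B, ℂ)ˣ) : C(B, ℂ)) b‖ * ∑ i, (z i b).re ^ 2 := by
        rw [norm_mul, hub, Complex.norm_real, Real.norm_of_nonneg hS]
      _ ≤ _ := by
        gcongr
        exact (ContinuousMap.norm_coe_le_norm _ _).trans hu'
  rw [one_div_mul_eq_div, one_le_div (by positivity)] at h2
  linarith

open Metric in
theorem exists_boundedRankLE_and_not {K : ℝ} (hK : 0 < K) {n : ℕ} (hKn : K ≤ n + 1) :
    ∃ (X : Type) (_ : CStarAlgebra X), IsSeparableOfBoundedRankLE K n X ∧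
      ∀ m < n, ¬ BoundedRankLE K m X := by
  have h1 : ⌈K⌉₊ ≤ n + 1 := Nat.ceil_le.2 (by exact_mod_cast hKn)
  have h2 : 0 < ⌈K⌉₊ := Nat.ceil_pos.2 hK
  -- With `d + ⌈K⌉ = n + 1` the upper bound holds for `n`. For `m < n` the truncated difference `m +
  -- 1 - d` is less than `⌈K⌉`, hence less than `K`; positivity of `⌈K⌉` covers the case where it is
  -- `0`.
  let d := n + 1 - ⌈K⌉₊
  have hd : d + ⌈K⌉₊ = n + 1 := Nat.sub_add_cancel h1
  have : CompactSpace (closedBall (0 : EuclideanSpace ℝ (Fin d)) 1) :=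
    isCompact_iff_compactSpace.1 (isCompact_closedBall _ _)
  refine ⟨C(closedBall (0 : EuclideanSpace ℝ (Fin d)) 1, ℂ), inferInstance, ⟨?_, ?_⟩, ?_⟩
  · infer_instance
  · refine boundedRankLE_continuousMap_closedBall hK ?_
    rw [finrank_euclideanSpace_fin]
    have : (d : ℝ) + ⌈K⌉₊ = n + 1 := by exact_mod_cast hd
    linarith [Nat.le_ceil K]
  · intro m hm
    apply not_boundedRankLE_continuousMap_closedBall
    have : m + 1 - d < ⌈K⌉₊ := by omega
    exact Nat.lt_ceil.1 this

/-! ### Bounded rank of `ℓ^∞`-products. -/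

noncomputable instance lp.instCStarAlgebraInfty {I : Type*} {A : I → Type*}
    [∀ i, CStarAlgebra (A i)] [∀ i, Nontrivial (A i)] : CStarAlgebra (lp A ∞) where
  toNormedRing := lp.inftyNormedRing
  toStarRing := lp.inftyStarRing
  toCompleteSpace := inferInstance
  toNormedAlgebra := lp.inftyNormedAlgebra
  toStarModule := inferInstance
  norm_mul_self_le _ := CStarRing.norm_star_mul_self.ge

section lp

variable {I : Type*} {A : I → Type*} [∀ i, CStarAlgebra (A i)] [∀ i, Nontrivial (A i)]

/-- Evaluation at an index, as a ⋆-homomorphism on the `ℓ^∞`-product. -/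
noncomputable def lp.evalStarAlgHom (i : I) : lp A ∞ →⋆ₐ[ℂ] A i where
  toFun x := x i
  map_one' := rfl
  map_mul' _ _ := rfl
  map_zero' := rfl
  map_add' _ _ := rfl
  commutes' _ := rfl
  map_star' _ := rfl

@[simp]
theorem lp.evalStarAlgHom_apply (i : I) (x : lp A ∞) : lp.evalStarAlgHom i x = x i := rfl

theorem lp.isSelfAdjoint_iff {x : lp A ∞} : IsSelfAdjoint x ↔ ∀ i, IsSelfAdjoint (x i) := by
  constructor
  · exact fun h i => h.map (lp.evalStarAlgHom i)
  · exact fun h => lp.ext (funext fun i => h i)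

/-- Witnesses are chosen in each factor. All estimates are uniform in the index, so the chosen
families, and in particular the inverses, are bounded and define elements of the product. -/
theorem BoundedRankLE.lp {K : ℝ} (hK : 0 < K) {n : ℕ} (h : ∀ i, BoundedRankLE K n (A i)) :
    BoundedRankLE K n (lp A ∞) := by
  intro x hx ε hε
  -- Half of `ε` is used because a strict inequality need not survive the supremum over the factors.
  choose y hy hxy using fun i => h i (fun k => x k i) (fun k => lp.isSelfAdjoint_iff.1 (hx k) i)
    (ε / 2) (half_pos hε)
  have hymem : ∀ k, Memℓp (fun i => x k i - y i k) ∞ := fun k =>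
    memℓp_infty ⟨ε / 2, by rintro _ ⟨i, rfl⟩; exact (hxy i k).le⟩
  let Y : Fin (n + 1) → _root_.lp A ∞ := fun k => x k - ⟨_, hymem k⟩
  have hY : ∀ k i, Y k i = y i k := fun k i => sub_sub_cancel _ _
  refine ⟨Y, ⟨fun k => lp.isSelfAdjoint_iff.2 fun i => ?_, fun δ hδ => ?_⟩, fun k => ?_⟩
  · rw [hY]; exact (hy i).1 k
  · have hδ' : (0 : ℝ) < δ := by exact_mod_cast hδ
    choose z hz hyz u hu hu' using fun i => (hy i).2 δ hδ
    have hzmem : ∀ k, Memℓp (fun i => y i k - z i k) ∞ := fun k =>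
      memℓp_infty ⟨δ, by rintro _ ⟨i, rfl⟩; exact hyz i k⟩
    let D : Fin (n + 1) → _root_.lp A ∞ := fun k => ⟨_, hzmem k⟩
    let Z : Fin (n + 1) → _root_.lp A ∞ := fun k => Y k - D k
    have hZ : ∀ k i, Z k i = z i k := fun k i => by
      change Y k i - (y i k - z i k) = z i k
      rw [hY, sub_sub_cancel]
    have hsum : ∀ i, (∑ k, Z k ^ 2 : _root_.lp A ∞) i = u i := fun i => by
      rw [hu, ← lp.evalStarAlgHom_apply, map_sum]
      exact Finset.sum_congr rfl fun k _ => by rw [map_pow, lp.evalStarAlgHom_apply, hZ]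
    let V : _root_.lp A ∞ := ⟨fun i => ((u i)⁻¹ : (A i)ˣ),
      memℓp_infty ⟨_, by rintro _ ⟨i, rfl⟩; exact hu' i⟩⟩
    refine ⟨Z, fun k => lp.isSelfAdjoint_iff.2 fun i => ?_, fun k => ?_,
      ⟨∑ k, Z k ^ 2, V, ?_, ?_⟩, rfl, ?_⟩
    · rw [hZ]; exact hz i k
    · rw [show Y k - Z k = D k from sub_sub_cancel _ _]
      exact lp.norm_le_of_forall_le hδ'.le fun i => hyz i k
    · refine lp.ext (funext fun i => ?_)
      change (∑ k, Z k ^ 2 : _root_.lp A ∞) i * V i = 1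
      rw [hsum]; exact (u i).mul_inv
    · refine lp.ext (funext fun i => ?_)
      change V i * (∑ k, Z k ^ 2 : _root_.lp A ∞) i = 1
      rw [hsum]; exact (u i).inv_mul
    · exact lp.norm_le_of_forall_le (by positivity) hu'
  · rw [show x k - Y k = ⟨_, hymem k⟩ from sub_sub_cancel _ _]
    exact (lp.norm_le_of_forall_le (half_pos hε).le fun i => (hxy i k).le).trans_lt
      (half_lt_self hε)

end lp

/-! ### Quotients, and closed range of ⋆-homomorphisms. -/

section maps

variable {X Y : Type*} [CStarAlgebra X] [CStarAlgebra Y]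

theorem IsUnessential.map {K : ℝ} {m : ℕ} {y : Fin m → X} (hy : IsUnessential K y)
    (φ : X →⋆ₐ[ℂ] Y) : IsUnessential K fun k => φ (y k) := by
  refine ⟨fun k => (hy.1 k).map φ, fun δ hδ => ?_⟩
  obtain ⟨z, hz, hyz, u, hu, hu'⟩ := hy.2 δ hδ
  refine ⟨fun k => φ (z k), fun k => (hz k).map φ, fun k => ?_,
    Units.map (φ : X →* Y) u, ?_, ?_⟩
  · rw [← map_sub]
    exact (NonUnitalStarAlgHom.norm_apply_le φ _).trans (hyz k)
  · simp [hu]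
  · exact (NonUnitalStarAlgHom.norm_apply_le φ _).trans hu'

theorem StarAlgHom.exists_isSelfAdjoint_of_apply {φ : X →⋆ₐ[ℂ] Y} {y : Y} (hy : IsSelfAdjoint y)
    {x : X} (hx : φ x = y) : ∃ x', IsSelfAdjoint x' ∧ φ x' = y := by
  refine ⟨((2⁻¹ : ℝ) : ℂ) • (x + star x), ?_, ?_⟩
  · rw [IsSelfAdjoint, star_smul, star_add, star_star, add_comm (star x),
      show star (((2⁻¹ : ℝ) : ℂ)) = ((2⁻¹ : ℝ) : ℂ) from Complex.conj_ofReal _]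
  · rw [map_smul, map_add, map_star, hx, hy.star_eq, ← two_smul ℂ y, smul_smul]
    norm_num

/-- Self-adjoint elements lift to self-adjoint elements, and ⋆-homomorphisms are contractive and
preserve inverses, so approximation upstairs descends with the same constants. -/
theorem BoundedRankLE.of_surjective {K : ℝ} {n : ℕ} (h : BoundedRankLE K n X)
    (φ : X →⋆ₐ[ℂ] Y) (hφ : Function.Surjective φ) : BoundedRankLE K n Y := by
  intro y hy ε hε
  choose x hx hxy using fun k =>
    StarAlgHom.exists_isSelfAdjoint_of_apply (φ := φ) (hy k) (hφ (y k)).choose_spec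
  obtain ⟨w, hw, hxw⟩ := h x hx ε hε
  refine ⟨_, hw.map φ, fun k => ?_⟩
  rw [← hxy, ← map_sub]
  exact (NonUnitalStarAlgHom.norm_apply_le φ _).trans_lt (hxw k)

theorem IsSeparableOfBoundedRankLE.of_surjective {K : ℝ} {n : ℕ}
    (h : IsSeparableOfBoundedRankLE K n X) (φ : X →⋆ₐ[ℂ] Y) (hφ : Function.Surjective φ) :
    IsSeparableOfBoundedRankLE K n Y := by
  have := h.1
  have hc : Continuous φ :=
    AddMonoidHomClass.continuous_of_bound φ 1 fun x => by
      simpa using NonUnitalStarAlgHom.norm_apply_le φ x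
  exact ⟨hφ.denseRange.separableSpace hc, h.2.of_surjective φ hφ⟩

/-- A self-adjoint lift is truncated by functional calculus at `±r`. The truncation is the identity
on the spectrum of `y`, so the image does not change. -/
theorem StarAlgHom.exists_lift_norm_le (φ : X →⋆ₐ[ℂ] Y) {y : Y} (hy : IsSelfAdjoint y)
    {r : ℝ} (hr : ‖y‖ ≤ r) (hmem : y ∈ Set.range φ) : ∃ x, φ x = y ∧ ‖x‖ ≤ r := by
  obtain ⟨x₀, hx₀⟩ := hmem
  obtain ⟨x, hx, hxy⟩ := StarAlgHom.exists_isSelfAdjoint_of_apply hy hx₀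
  have hr0 : 0 ≤ r := (norm_nonneg y).trans hr
  let f : ℝ → ℝ := fun t => max (-r) (min r t)
  have hf : Continuous f := by fun_prop
  have hφc : Continuous φ :=
    AddMonoidHomClass.continuous_of_bound φ 1 fun x => by
      simpa using NonUnitalStarAlgHom.norm_apply_le φ x
  refine ⟨cfc f x, ?_, ?_⟩
  · have h1 : φ (cfc f x) = cfc f (φ x) :=
      (φ.restrictScalars ℝ).map_cfc f x hf.continuousOn hφc hx (hx.map φ)
    rw [h1, hxy]
    conv_rhs => rw [← cfc_id ℝ y]
    refine cfc_congr fun t ht => ?_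
    have ht' : |t| ≤ r := by
      rcases subsingleton_or_nontrivial Y with h | h
      · exact absurd ht (by simp [spectrum.of_subsingleton])
      · exact (spectrum.norm_le_norm_of_mem ht).trans hr
    rw [abs_le] at ht'
    simp only [f, id, min_eq_right ht'.2, max_eq_right ht'.1]
  · refine norm_cfc_le hr0 fun t _ => ?_
    rw [Real.norm_eq_abs, abs_le]
    exact ⟨le_max_left _ _, max_le (by linarith) (min_le_left _ _)⟩

open scoped ComplexStarModule in
/-- A ⋆-homomorphism of C⋆-algebras has closed range. -/
theorem StarAlgHom.surjective_of_denseRange (φ : X →⋆ₐ[ℂ] Y) (hφ : DenseRange φ) :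
    Function.Surjective φ := by
  let f : NormedAddGroupHom X Y := (φ : X →+ Y).mkNormedAddGroupHom 1 fun x => by
    simpa using NonUnitalStarAlgHom.norm_apply_le φ x
  -- Real and imaginary parts are lifted separately without increase of norm, whence the constant
  -- `2`. Such control on the range extends to its closure by completeness.
  have hsurj : f.SurjectiveOnWith f.range 2 := by
    rintro _ ⟨x, rfl⟩
    have hfx : f x = φ x := rfl
    obtain ⟨a, ha, ha'⟩ := φ.exists_lift_norm_le (y := (ℜ (φ x) : Y)) (ℜ (φ x)).2
      (realPart.norm_le (φ x)) ⟨(ℜ x : X), by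
        rw [realPart_apply_coe, realPart_apply_coe, ← map_star, ← map_add]
        exact map_smul (φ.restrictScalars ℝ) _ _⟩
    obtain ⟨b, hb, hb'⟩ := φ.exists_lift_norm_le (y := (ℑ (φ x) : Y)) (ℑ (φ x)).2
      (imaginaryPart.norm_le (φ x)) ⟨(ℑ x : X), by
        rw [imaginaryPart_apply_coe, imaginaryPart_apply_coe, ← map_star, ← map_sub, map_smul]
        congr 1
        exact map_smul (φ.restrictScalars ℝ) _ _⟩
    refine ⟨a + Complex.I • b, ?_, ?_⟩
    · change φ (a + Complex.I • b) = φ x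
      rw [map_add, map_smul, ha, hb, realPart_add_I_smul_imaginaryPart]
    · calc ‖a + Complex.I • b‖ ≤ ‖a‖ + ‖Complex.I • b‖ := norm_add_le _ _
        _ = ‖a‖ + ‖b‖ := by rw [norm_smul, Complex.norm_I, one_mul]
        _ ≤ 2 * ‖f x‖ := by rw [hfx]; linarith
  have := controlled_closure_of_complete two_pos one_pos hsurj
  intro y
  have hy : y ∈ f.range.topologicalClosure := by
    change y ∈ closure (f.range : Set Y)
    have : (f.range : Set Y) = Set.range φ := by ext; simp [f, NormedAddGroupHom.mem_range]
    rw [this]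
    exact hφ y
  obtain ⟨x, hx, -⟩ := this y hy
  exact ⟨x, hx⟩

end maps

/-! ### Separable subalgebras of the same bounded rank. -/

theorem Submonoid.countable_closure {M : Type*} [Monoid M] {s : Set M} (hs : s.Countable) :
    (Submonoid.closure s : Set M).Countable := by
  have := hs.to_subtype
  have : Countable (FreeMonoid s) := inferInstanceAs (Countable (List s))
  rw [Submonoid.closure_eq_mrange, MonoidHom.coe_mrange]
  exact Set.countable_range _

theorem StarAlgebra.isSeparable_adjoin {P : Type*} [CStarAlgebra P] {s : Set P}
    (hs : s.Countable) : IsSeparable (StarAlgebra.adjoin ℂ s : Set P) := by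
  have h1 : (StarAlgebra.adjoin ℂ s : Set P) =
      (Submodule.span ℂ (Submonoid.closure (s ∪ star s) : Set P) : Set P) := by
    rw [← StarAlgebra.adjoin_eq_span]; rfl
  have h2 : (star s).Countable := by
    rw [← Set.image_star]; exact hs.image _
  rw [h1]
  exact (Submonoid.countable_closure (hs.union h2)).isSeparable.span

section subalgebra

variable {P : Type*} [CStarAlgebra P]

/-- The condition of being `K`-unessential, witnessed by elements of a subset `W`. -/
def IsUnessentialIn (K : ℝ) (W : Set P) {m : ℕ} (y : Fin m → P) : Prop :=
  (∀ k, IsSelfAdjoint (y k)) ∧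
    ∀ δ : ℚ, 0 < δ → ∃ z : Fin m → P, (∀ k, z k ∈ W) ∧ (∀ k, IsSelfAdjoint (z k)) ∧
      (∀ k, ‖y k - z k‖ ≤ (δ : ℝ)) ∧
      ∃ u : Pˣ, (u : P) = ∑ k, z k ^ 2 ∧ ((u⁻¹ : Pˣ) : P) ∈ W ∧
        ‖((u⁻¹ : Pˣ) : P)‖ ≤ 1 / (K * (δ : ℝ) ^ 2)

/-- Countability rests on `δ` ranging over the rationals: each `δ` contributes finitely many
witnesses. -/
theorem IsUnessential.exists_countable {K : ℝ} {m : ℕ} {y : Fin m → P} (hy : IsUnessential K y) :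
    ∃ W : Set P, W.Countable ∧ (∀ k, y k ∈ W) ∧ IsUnessentialIn K W y := by
  choose z hz hyz u hu hu' using hy.2
  let W : Set P := Set.range y ∪ (⋃ δ : {δ : ℚ // 0 < δ}, Set.range (z δ.1 δ.2)) ∪
    Set.range fun δ : {δ : ℚ // 0 < δ} => (((u δ.1 δ.2)⁻¹ : Pˣ) : P)
  refine ⟨W, ?_, fun k => Or.inl (Or.inl ⟨k, rfl⟩), hy.1, fun δ hδ => ⟨z δ hδ, fun k => ?_,
    hz δ hδ, hyz δ hδ, u δ hδ, hu δ hδ, Or.inr ⟨⟨δ, hδ⟩, rfl⟩, hu' δ hδ⟩⟩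
  · exact ((Set.countable_range _).union
      (Set.countable_iUnion fun _ => Set.countable_range _)).union (Set.countable_range _)
  · exact Or.inl (Or.inr (Set.mem_iUnion.2 ⟨⟨δ, hδ⟩, ⟨k, rfl⟩⟩))

/-- The inverses are among the recorded witnesses, so the sums of squares are invertible inside the
subalgebra itself. -/
theorem IsUnessentialIn.toSubalgebra {K : ℝ} {m : ℕ} {W : Set P} {y : Fin m → P}
    (hy : IsUnessentialIn K W y) (A : StarSubalgebra ℂ P) [IsClosed (A : Set P)]
    (hW : W ⊆ A) (hyA : ∀ k, y k ∈ A) :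
    IsUnessential K (fun k => (⟨y k, hyA k⟩ : A)) := by
  refine ⟨fun k => Subtype.ext (hy.1 k), fun δ hδ => ?_⟩
  obtain ⟨z, hzW, hz, hyz, u, hu, huW, hu'⟩ := hy.2 δ hδ
  have huA : (u : P) ∈ A := hu ▸ sum_mem fun k _ => pow_mem (hW (hzW k)) 2
  refine ⟨fun k => ⟨z k, hW (hzW k)⟩, fun k => Subtype.ext (hz k), hyz,
    ⟨⟨u, huA⟩, ⟨_, hW huW⟩, Subtype.ext u.mul_inv, Subtype.ext u.inv_mul⟩, ?_, hu'⟩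
  refine Subtype.ext (hu.trans ?_)
  simp

theorem exists_countable_dense_isSelfAdjoint (D : Set P) (hD : D.Countable) :
    ∃ E : Set P, E.Countable ∧ (∀ x ∈ E, IsSelfAdjoint x) ∧
      ∀ x ∈ StarAlgebra.adjoin ℂ D, IsSelfAdjoint x → ∀ ε > 0, ∃ e ∈ E, ‖x - e‖ < ε := by
  have hsep : IsSeparable {x | x ∈ StarAlgebra.adjoin ℂ D ∧ IsSelfAdjoint x} :=
    (StarAlgebra.isSeparable_adjoin hD).mono fun x hx => hx.1
  obtain ⟨E, hE, hEc, hEd⟩ := hsep.exists_countable_dense_subset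
  refine ⟨E, hEc, fun x hx => (hE hx).2, fun x hx hxs ε hε => ?_⟩
  obtain ⟨e, he, hxe⟩ := Metric.mem_closure_iff.1 (hEd ⟨hx, hxs⟩) ε hε
  exact ⟨e, he, by rwa [← dist_eq_norm]⟩

/-- Closing off a countable set under witnesses of bounded rank, one step. -/
theorem BoundedRankLE.exists_countable_step {K : ℝ} {n : ℕ} (h : BoundedRankLE K n P)
    (D : Set P) (hD : D.Countable) : ∃ D' : Set P, D'.Countable ∧ D ⊆ D' ∧
      ∀ x : Fin (n + 1) → P, (∀ k, x k ∈ StarAlgebra.adjoin ℂ D) → (∀ k, IsSelfAdjoint (x k)) →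
        ∀ ε > 0, ∃ y : Fin (n + 1) → P, (∀ k, y k ∈ D') ∧ IsUnessentialIn K D' y ∧
          ∀ k, ‖x k - y k‖ < ε := by
  obtain ⟨E, hE, hEs, hEd⟩ := exists_countable_dense_isSelfAdjoint D hD
  have : Countable E := hE.to_subtype
  -- Only tuples from a countable dense set `E` and tolerances `1 / (j + 1)` are treated, which
  -- keeps the set of added witnesses countable.
  choose y hy hxy using fun (e : Fin (n + 1) → E) (j : ℕ) =>
    h (fun k => e k) (fun k => hEs _ (e k).2) (1 / (j + 1)) Nat.one_div_pos_of_nat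
  choose W hW hyW hyU using fun e j => (hy e j).exists_countable
  refine ⟨D ∪ ⋃ e, ⋃ j, W e j, hD.union (Set.countable_iUnion fun e =>
    Set.countable_iUnion fun j => hW e j), Set.subset_union_left, ?_⟩
  intro x hx hxs ε hε
  obtain ⟨j, hj⟩ := exists_nat_one_div_lt (half_pos hε)
  choose e he hxe using fun k => hEd (x k) (hx k) (hxs k) (ε / 2) (half_pos hε)
  let e' : Fin (n + 1) → E := fun k => ⟨e k, he k⟩
  have hsub : W e' j ⊆ D ∪ ⋃ e, ⋃ j, W e j :=
    (Set.subset_iUnion_of_subset e' (Set.subset_iUnion _ j)).trans Set.subset_union_right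
  refine ⟨y e' j, fun k => hsub (hyW e' j k), ⟨(hyU e' j).1, fun δ hδ => ?_⟩, fun k => ?_⟩
  · obtain ⟨z, hz, hz', hyz, u, hu, huW, hu'⟩ := (hyU e' j).2 δ hδ
    exact ⟨z, fun k => hsub (hz k), hz', hyz, u, hu, hsub huW, hu'⟩
  · calc ‖x k - y e' j k‖ = ‖(x k - e k) + (e k - y e' j k)‖ := by rw [sub_add_sub_cancel]
      _ ≤ ‖x k - e k‖ + ‖e k - y e' j k‖ := norm_add_le _ _
      _ < ε / 2 + ε / 2 := add_lt_add (hxe k) ((hxy e' j k).trans hj)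
      _ = ε := add_halves ε

theorem StarAlgebra.exists_mem_adjoin_of_monotone {D : ℕ → Set P} (hD : Monotone D) {x : P}
    (hx : x ∈ StarAlgebra.adjoin ℂ (⋃ i, D i)) : ∃ i, x ∈ StarAlgebra.adjoin ℂ (D i) := by
  have hmono : ∀ {i j}, i ≤ j → StarAlgebra.adjoin ℂ (D i) ≤ StarAlgebra.adjoin ℂ (D j) :=
    fun hij => StarAlgebra.adjoin_mono (hD hij)
  induction hx using StarAlgebra.adjoin_induction with
  | mem x hx =>
    obtain ⟨i, hi⟩ := Set.mem_iUnion.1 hx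
    exact ⟨i, StarAlgebra.subset_adjoin ℂ _ hi⟩
  | algebraMap r => exact ⟨0, algebraMap_mem _ r⟩
  | add x y _ _ hx hy =>
    obtain ⟨i, hi⟩ := hx
    obtain ⟨j, hj⟩ := hy
    exact ⟨max i j, add_mem (hmono (le_max_left _ _) hi) (hmono (le_max_right _ _) hj)⟩
  | mul x y _ _ hx hy =>
    obtain ⟨i, hi⟩ := hx
    obtain ⟨j, hj⟩ := hy
    exact ⟨max i j, mul_mem (hmono (le_max_left _ _) hi) (hmono (le_max_right _ _) hj)⟩
  | star x _ hx =>
    obtain ⟨i, hi⟩ := hx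
    exact ⟨i, star_mem hi⟩

/-- A Löwenheim–Skolem theorem for bounded rank: every countable subset lies in a separable
C⋆-subalgebra of the same bounded rank. -/
theorem BoundedRankLE.exists_separable_subalgebra {K : ℝ} {n : ℕ} (h : BoundedRankLE K n P)
    {S : Set P} (hS : S.Countable) :
    ∃ (A : StarSubalgebra ℂ P) (_ : IsClosed (A : Set P)), S ⊆ A ∧
      IsSeparableOfBoundedRankLE K n A := by
  choose! Φ hΦc hΦs hΦ using h.exists_countable_step
  -- Stage `i + 1` contains witnesses for all self-adjoint tuples in the algebra generated by stage
  -- `i`, so the union is closed under the closing-off operation.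
  let D : ℕ → Set P := fun i => Φ^[i] S
  have hDs : ∀ i, D (i + 1) = Φ (D i) := fun i => Function.iterate_succ_apply' _ _ _
  have hDc : ∀ i, (D i).Countable := fun i => by
    induction i with
    | zero => exact hS
    | succ i ih => rw [hDs]; exact hΦc _ ih
  have hDm : Monotone D := monotone_nat_of_le_succ fun i => by
    rw [hDs]; exact hΦs _ (hDc i)
  let A := (StarAlgebra.adjoin ℂ (⋃ i, D i)).topologicalClosure
  have hA : IsClosed (A : Set P) := StarSubalgebra.isClosed_topologicalClosure _
  have hDA : ∀ i, D i ⊆ A := fun i => (Set.subset_iUnion D i).trans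
    ((StarAlgebra.subset_adjoin ℂ _).trans (StarSubalgebra.le_topologicalClosure _))
  refine ⟨A, hA, hDA 0, ?_, ?_⟩
  · have : IsSeparable (A : Set P) :=
      (StarAlgebra.isSeparable_adjoin (Set.countable_iUnion hDc)).closure
    exact this.separableSpace
  · intro x hx ε hε
    -- Passing from an approximant to its self-adjoint part does not increase the distance to the
    -- self-adjoint `x k`.
    have happ : ∀ k, ∃ i, ∃ a ∈ StarAlgebra.adjoin ℂ (D i), IsSelfAdjoint a ∧
        ‖(x k : P) - a‖ < ε / 2 := by
      intro k
      obtain ⟨a, ha, hxa⟩ := Metric.mem_closure_iff.1 (x k).2 (ε / 2) (half_pos hε)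
      obtain ⟨i, hi⟩ := StarAlgebra.exists_mem_adjoin_of_monotone hDm ha
      rw [dist_eq_norm] at hxa
      have hxs : star (x k : P) = x k := congrArg Subtype.val (hx k)
      refine ⟨i, ((2⁻¹ : ℝ) : ℂ) • (a + star a), SMulMemClass.smul_mem _
        (add_mem hi (star_mem hi)), ?_, ?_⟩
      · rw [IsSelfAdjoint, star_smul, star_add, star_star, add_comm (star a),
          show star (((2⁻¹ : ℝ) : ℂ)) = ((2⁻¹ : ℝ) : ℂ) from Complex.conj_ofReal _]
      · have h1 : (x k : P) - ((2⁻¹ : ℝ) : ℂ) • (a + star a) =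
            ((2⁻¹ : ℝ) : ℂ) • (((x k : P) - a) + star ((x k : P) - a)) := by
          rw [star_sub, hxs, show ((x k : P) - a) + ((x k : P) - star a) =
            (2 : ℂ) • (x k : P) - (a + star a) by rw [two_smul]; abel, smul_sub, smul_smul]
          norm_num
        rw [h1, norm_smul, Complex.norm_real, Real.norm_of_nonneg (by norm_num)]
        have h2 := norm_add_le ((x k : P) - a) (star ((x k : P) - a))
        rw [norm_star] at h2
        linarith
    choose i a ha has hxa using happ
    -- A finite tuple lies in a single stage, and its witnesses lie in the next one.
    let I := Finset.univ.sup i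
    obtain ⟨y, hyD, hyU, hay⟩ := hΦ (D I) (hDc I) a
      (fun k => StarAlgebra.adjoin_mono (hDm (Finset.le_sup (Finset.mem_univ k))) (ha k)) has
      (ε / 2) (half_pos hε)
    have hsub : Φ (D I) ⊆ A := by rw [← hDs]; exact hDA _
    refine ⟨_, hyU.toSubalgebra A hsub fun k => hsub (hyD k), fun k => ?_⟩
    calc ‖(x k : P) - y k‖ = ‖((x k : P) - a k) + (a k - y k)‖ := by rw [sub_add_sub_cancel]
      _ ≤ ‖(x k : P) - a k‖ + ‖a k - y k‖ := norm_add_le _ _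
      _ < ε / 2 + ε / 2 := add_lt_add (hxa k) (hay k)
      _ = ε := add_halves ε

end subalgebra

/-! ### Universal property of the full group C⋆-algebra. -/

namespace GroupCStarAlgebra

variable {G : Type*} [Group G] {X : Type*} [CStarAlgebra X]

/-- The ⋆-homomorphism on the group algebra induced by a unitary representation. -/
noncomputable def liftAux (π : G →* unitary X) : MonoidAlgebra ℂ G →ₐ[ℂ] X :=
  MonoidAlgebra.lift ℂ X G ((unitary X).subtype.comp π)

theorem liftAux_single (π : G →* unitary X) (g : G) (c : ℂ) :
    liftAux π (MonoidAlgebra.single g c) = c • (π g : X) := by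
  simp [liftAux]

theorem liftAux_star (π : G →* unitary X) (a : MonoidAlgebra ℂ G) :
    liftAux π (star a) = star (liftAux π a) := by
  induction a using MonoidAlgebra.induction_linear with
  | zero => simp
  | add f g hf hg => rw [star_add, map_add, map_add, star_add, hf, hg]
  | single g c =>
    rw [MonoidAlgebra.star_single', liftAux_single, liftAux_single, star_smul, map_inv]
    rfl

/-- The C⋆-seminorm on the group algebra induced by a unitary representation. -/
noncomputable def liftSeminorm (π : G →* unitary X) : CStarSeminorm (MonoidAlgebra ℂ G) where
  toSeminorm := (normSeminorm ℂ X).comp (liftAux π).toLinearMap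
  mul_le' a b := by
    change ‖liftAux π (a * b)‖ ≤ ‖liftAux π a‖ * ‖liftAux π b‖
    rw [map_mul]
    exact norm_mul_le _ _
  star_mul_self' a := by
    change ‖liftAux π (star a * a)‖ = ‖liftAux π a‖ ^ 2
    rw [map_mul, liftAux_star, CStarRing.norm_star_mul_self, sq]

theorem norm_liftAux_le (π : G →* unitary X) (a : MonoidAlgebra ℂ G) : ‖liftAux π a‖ ≤ ‖a‖ :=
  le_fullGroupNorm (liftSeminorm π) a

theorem uniformContinuous_liftAux (π : G →* unitary X) : UniformContinuous (liftAux π) :=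
  (AddMonoidHomClass.lipschitz_of_bound (liftAux π) 1 fun a => by
    simpa using norm_liftAux_le π a).uniformContinuous

/-- The extension to `C⋆(G)` of the representation induced by a unitary representation. -/
noncomputable def liftFun (π : G →* unitary X) : GroupCStarAlgebra G → X :=
  UniformSpace.Completion.extension (liftAux π)

theorem continuous_liftFun (π : G →* unitary X) : Continuous (liftFun π) :=
  UniformSpace.Completion.continuous_extension

theorem liftFun_ι (π : G →* unitary X) (a : MonoidAlgebra ℂ G) : liftFun π (ι a) = liftAux π a :=
  UniformSpace.Completion.extension_coe (uniformContinuous_liftAux π) a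

theorem ι_one : ι (1 : MonoidAlgebra ℂ G) = 1 := rfl

/-- The universal property of the full group C⋆-algebra. -/
noncomputable def lift (π : G →* unitary X) : GroupCStarAlgebra G →⋆ₐ[ℂ] X :=
  { AlgHom.ofLinearMap
      { toFun := liftFun π
        map_add' := fun x y => by
          refine denseRange_ι.induction_on₂
            (p := fun x y : GroupCStarAlgebra G => liftFun π (x + y) = liftFun π x + liftFun π y)
            (isClosed_eq ((continuous_liftFun π).comp continuous_add)
              (((continuous_liftFun π).comp continuous_fst).add
                ((continuous_liftFun π).comp continuous_snd))) (fun a b => ?_) x y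
          rw [← ι_add, liftFun_ι, liftFun_ι, liftFun_ι, map_add]
        map_smul' := fun c x => by
          refine denseRange_ι.induction_on x
            (isClosed_eq ((continuous_liftFun π).comp (continuous_const_smul c))
              ((continuous_liftFun π).const_smul c)) fun a => ?_
          rw [← ι_smul, liftFun_ι, liftFun_ι, map_smul, RingHom.id_apply] }
      (by
        change liftFun π 1 = 1
        rw [← ι_one, liftFun_ι, map_one])
      (fun x y => by
        change liftFun π (x * y) = liftFun π x * liftFun π y
        refine denseRange_ι.induction_on₂
          (p := fun x y : GroupCStarAlgebra G => liftFun π (x * y) = liftFun π x * liftFun π y)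
          (isClosed_eq ((continuous_liftFun π).comp continuous_mul)
            (((continuous_liftFun π).comp continuous_fst).mul
              ((continuous_liftFun π).comp continuous_snd))) (fun a b => ?_) x y
        rw [← ι_mul, liftFun_ι, liftFun_ι, liftFun_ι, map_mul]) with
    map_star' := fun x => by
      change liftFun π (star x) = star (liftFun π x)
      refine denseRange_ι.induction_on x
        (isClosed_eq ((continuous_liftFun π).comp continuous_star')
          (continuous_star.comp (continuous_liftFun π))) fun a => ?_
      rw [star_ι, liftFun_ι, liftFun_ι, liftAux_star] }

theorem lift_ι_single (π : G →* unitary X) (g : G) :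
    lift π (ι (MonoidAlgebra.single g 1)) = π g := by
  change liftFun π _ = _
  rw [liftFun_ι, liftAux_single, one_smul]

/-- A closed star subalgebra containing the images of all group elements contains the range. -/
theorem apply_mem_of_forall_single_mem (φ : GroupCStarAlgebra G →⋆ₐ[ℂ] X)
    (A : StarSubalgebra ℂ X) (hA : IsClosed (A : Set X))
    (h : ∀ g, φ (ι (MonoidAlgebra.single g 1)) ∈ A) (x : GroupCStarAlgebra G) : φ x ∈ A := by
  have hφ : Continuous φ :=
    AddMonoidHomClass.continuous_of_bound φ 1 fun x => by
      simpa using NonUnitalStarAlgHom.norm_apply_le φ x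
  refine denseRange_ι.induction_on x (hA.preimage hφ) fun a => ?_
  induction a using MonoidAlgebra.induction_linear with
  | zero =>
    have : ι (0 : MonoidAlgebra ℂ G) = 0 := rfl
    rw [this, map_zero]
    exact zero_mem A
  | add f g hf hg => rw [ι_add, map_add]; exact add_mem hf hg
  | single g c =>
    rw [show (MonoidAlgebra.single g c : MonoidAlgebra ℂ G) = c • MonoidAlgebra.single g 1 by
      rw [MonoidAlgebra.smul_single, smul_eq_mul, mul_one], ι_smul, map_smul]
    exact SMulMemClass.smul_mem c (h g)

/-- Every separable unital C⋆-algebra is a quotient of `C⋆(𝔽_∞)`. -/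
theorem exists_surjective_of_separableSpace [SeparableSpace X] :
    ∃ φ : GroupCStarAlgebra (FreeGroup ℕ) →⋆ₐ[ℂ] X, Function.Surjective φ := by
  have : Nonempty (unitary X) := ⟨1⟩
  have : SeparableSpace (unitary X) :=
    (IsSeparable.of_separableSpace (unitary X : Set X)).separableSpace
  let v : ℕ → unitary X := denseSeq (unitary X)
  let φ := lift (FreeGroup.lift v)
  have hv : ∀ i, φ (ι (MonoidAlgebra.single (FreeGroup.of i) 1)) = v i := fun i => by
    rw [lift_ι_single, FreeGroup.lift_apply_of]
  refine ⟨φ, StarAlgHom.surjective_of_denseRange φ ?_⟩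
  let A : StarSubalgebra ℂ X := φ.range.topologicalClosure
  have hU : ∀ u : unitary X, (u : X) ∈ A := fun u => by
    refine (denseRange_denseSeq (unitary X)).induction_on u
      (StarSubalgebra.isClosed_topologicalClosure _ |>.preimage continuous_subtype_val) fun i => ?_
    rw [← show _ = (denseSeq (unitary X) i : X) from hv i]
    exact StarSubalgebra.le_topologicalClosure _ ⟨_, rfl⟩
  -- The unitaries span a unital C⋆-algebra, so a closed subalgebra containing a dense sequence of
  -- them is everything.
  have htop : Submodule.span ℂ (unitary X : Set X) ≤ A.toSubalgebra.toSubmodule :=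
    Submodule.span_le.2 fun u hu => hU ⟨u, hu⟩
  rw [CStarAlgebra.span_unitary] at htop
  intro x
  have hx : x ∈ closure (φ.range : Set X) := htop (Submodule.mem_top (x := x))
  exact hx

end GroupCStarAlgebra

/-! ### The universal algebra. -/

/-- Transfer of a C⋆-algebra structure along a bijection. -/
theorem Equiv.exists_cstarAlgebra {S : Type*} {X : Type*} [CStarAlgebra X] (e : S ≃ X) :
    ∃ _ : CStarAlgebra S, Nonempty (S ≃⋆ₐ[ℂ] X) := by
  let r : Ring S := e.ring
  let a : Algebra ℂ S := e.algebra ℂ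
  let st : StarRing S := e.starRing
  have hsm : StarModule ℂ S := e.starModule ℂ
  let φ : S ≃ₐ[ℂ] X := e.algEquiv ℂ
  have hφ : ∀ s, φ s = e s := fun _ => rfl
  have hstar : ∀ s, φ (star s) = star (φ s) := fun s => e.apply_symm_apply _
  let nr : NormedRing S := NormedRing.induced S X φ φ.injective
  let na : NormedAlgebra ℂ S := NormedAlgebra.induced ℂ S X φ
  have hnorm : ∀ s : S, ‖s‖ = ‖φ s‖ := fun _ => rfl
  have hiso : Isometry φ := AddMonoidHomClass.isometry_of_norm φ fun s => (hnorm s).symm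
  have hc : CompleteSpace S :=
    (completeSpace_iff_isComplete_range hiso.isUniformInducing).2 <| by
      rw [φ.surjective.range_eq]; exact isComplete_univ
  have hcs : CStarRing S := ⟨fun s => by
    rw [hnorm, hnorm, map_mul, hstar]
    exact CStarRing.norm_star_mul_self.ge⟩
  exact ⟨{ nr, st, na with
    toCompleteSpace := hc
    toCStarRing := hcs
    toStarModule := hsm }, ⟨StarAlgEquiv.ofAlgEquiv φ hstar⟩⟩

/-- Every separable C⋆-algebra has a copy on a set of real sequences. -/
theorem exists_starAlgEquiv_set {X : Type*} [CStarAlgebra X] [SeparableSpace X] :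
    ∃ (S : Set (ℕ → ℝ)) (_ : CStarAlgebra S), Nonempty (S ≃⋆ₐ[ℂ] X) := by
  -- A point is determined by its distances to a dense sequence. This puts a copy of `X` in `Type`,
  -- whatever the universe of `X`.
  let f : X → ℕ → ℝ := fun x i => dist x (denseSeq X i)
  have hf : Function.Injective f := by
    intro x y hxy
    have : ∀ z, dist x z = dist y z := fun z =>
      (denseRange_denseSeq X).induction_on z
        (isClosed_eq (continuous_const.dist continuous_id) (continuous_const.dist continuous_id))
        fun i => congrFun hxy i
    exact dist_eq_zero.1 (by rw [this y, dist_self])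
  exact ⟨Set.range f, (Equiv.ofInjective f hf).symm.exists_cstarAlgebra⟩

/-- The index set of the product defining the universal algebra: ⋆-homomorphisms from `C⋆(𝔽_∞)` to
nontrivial separable C⋆-algebras of bounded rank at most `n` carried by sets of real sequences. -/
structure BoundedRankIndex (K : ℝ) (n : ℕ) where
  carrier : Set (ℕ → ℝ)
  cstarAlgebra : CStarAlgebra carrier
  nontrivial : Nontrivial carrier
  isSeparableOfBoundedRankLE : IsSeparableOfBoundedRankLE K n carrier
  hom : GroupCStarAlgebra (FreeGroup ℕ) →⋆ₐ[ℂ] carrier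

attribute [instance] BoundedRankIndex.cstarAlgebra BoundedRankIndex.nontrivial

namespace BoundedRankIndex

variable (K : ℝ) (n : ℕ)

/-- The `ℓ^∞`-product of all codomains in the index set. -/
abbrev Product : Type := lp (fun t : BoundedRankIndex K n => (t.carrier : Type)) ∞

theorem memℓp_hom (x : GroupCStarAlgebra (FreeGroup ℕ)) :
    Memℓp (fun t : BoundedRankIndex K n => t.hom x) ∞ :=
  memℓp_infty ⟨‖x‖, by rintro _ ⟨t, rfl⟩; exact NonUnitalStarAlgHom.norm_apply_le t.hom x⟩

/-- The diagonal ⋆-homomorphism from `C⋆(𝔽_∞)` into the product. -/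
noncomputable def diagonal : GroupCStarAlgebra (FreeGroup ℕ) →⋆ₐ[ℂ] Product K n where
  toFun x := ⟨fun t => t.hom x, memℓp_hom K n x⟩
  map_one' := lp.ext (funext fun t => map_one t.hom)
  map_mul' x y := lp.ext (funext fun t => map_mul t.hom x y)
  map_zero' := lp.ext (funext fun t => map_zero t.hom)
  map_add' x y := lp.ext (funext fun t => map_add t.hom x y)
  commutes' c := lp.ext (funext fun t => AlgHomClass.commutes t.hom c)
  map_star' x := lp.ext (funext fun t => map_star t.hom x)

end BoundedRankIndex

/-- The unital ⋆-homomorphism into a zero algebra. -/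
def StarAlgHom.ofSubsingleton (A B : Type*) [CStarAlgebra A] [CStarAlgebra B] [Subsingleton B] :
    A →⋆ₐ[ℂ] B where
  toFun _ := 0
  map_one' := Subsingleton.elim _ _
  map_mul' _ _ := Subsingleton.elim _ _
  map_zero' := rfl
  map_add' _ _ := Subsingleton.elim _ _
  commutes' _ := Subsingleton.elim _ _
  map_star' _ := Subsingleton.elim _ _

/-- If `X` is separable with `br_K(X) ≤ n`, then every unital ⋆-homomorphism `C⋆(𝔽_∞) → X` factors
through `p`. -/
def IsBoundedRankInvertible (K : ℝ) (n : ℕ) {Z : Type} [CStarAlgebra Z]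
    (p : GroupCStarAlgebra (FreeGroup ℕ) →⋆ₐ[ℂ] Z) (X : Type*) [CStarAlgebra X] : Prop :=
  IsSeparableOfBoundedRankLE K n X → ∀ g : GroupCStarAlgebra (FreeGroup ℕ) →⋆ₐ[ℂ] X,
    ∃ h : Z →⋆ₐ[ℂ] X, g = h.comp p

/-- Up to isomorphism the given homomorphism is itself a member of the index set, so evaluation at
its own coordinate undoes the diagonal map. -/
theorem isBoundedRankInvertible_codRestrict {K : ℝ} {n : ℕ}
    (A : StarSubalgebra ℂ (BoundedRankIndex.Product K n))
    [IsClosed (A : Set (BoundedRankIndex.Product K n))]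
    (hp : ∀ x, BoundedRankIndex.diagonal K n x ∈ A) (X : Type*) [CStarAlgebra X] :
    IsBoundedRankInvertible K n ((BoundedRankIndex.diagonal K n).codRestrict A hp) X := by
  intro hX g
  rcases subsingleton_or_nontrivial X with hs | hnt
  -- The zero algebra is not among the factors and is treated separately.
  · exact ⟨StarAlgHom.ofSubsingleton _ _, StarAlgHom.ext fun x => Subsingleton.elim _ _⟩
  · have := hX.1
    obtain ⟨S, hS, ⟨e⟩⟩ := exists_starAlgEquiv_set (X := X)
    let t : BoundedRankIndex K n :=
      { carrier := S
        cstarAlgebra := hS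
        nontrivial := e.toEquiv.nontrivial
        isSeparableOfBoundedRankLE :=
          hX.of_surjective (e.symm : X →⋆ₐ[ℂ] S) e.symm.surjective
        hom := (e.symm : X →⋆ₐ[ℂ] S).comp g }
    let ev : BoundedRankIndex.Product K n →⋆ₐ[ℂ] S := lp.evalStarAlgHom t
    refine ⟨(e : S →⋆ₐ[ℂ] X).comp (ev.comp A.subtype), StarAlgHom.ext fun x => ?_⟩
    exact (e.apply_symm_apply (g x)).symm

theorem IsBoundedRankInvertible.exists_surjective {K : ℝ} {n : ℕ} {Z : Type} [CStarAlgebra Z]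
    {p : GroupCStarAlgebra (FreeGroup ℕ) →⋆ₐ[ℂ] Z} {X : Type*} [CStarAlgebra X]
    (h : IsBoundedRankInvertible K n p X) (hX : IsSeparableOfBoundedRankLE K n X) :
    ∃ q : Z →⋆ₐ[ℂ] X, Function.Surjective q := by
  have := hX.1
  obtain ⟨g, hg⟩ := GroupCStarAlgebra.exists_surjective_of_separableSpace (X := X)
  obtain ⟨q, hq⟩ := h hX g
  refine ⟨q, Function.Surjective.of_comp (g := p) ?_⟩
  rw [← StarAlgHom.coe_comp, ← hq]
  exact hg

theorem boundedRank_eq_of_forall_not {K : ℝ} {n : ℕ} {Z : Type*} [CStarAlgebra Z]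
    (h : BoundedRankLE K n Z) (h' : ∀ m < n, ¬ BoundedRankLE K m Z) : boundedRank K Z = n := by
  refine le_antisymm (sInf_le ⟨n, rfl, h⟩) (le_sInf ?_)
  rintro _ ⟨m, rfl, hm⟩
  exact_mod_cast not_lt.1 fun hlt => h' m hlt hm

theorem theorem4p4 (K : ℝ) (hK : 0 < K) (n : ℕ) :
    ∃ (Z : Type) (_ : CStarAlgebra Z) (p : GroupCStarAlgebra (FreeGroup ℕ) →⋆ₐ[ℂ] Z),
      IsSeparableOfBoundedRankLE K n Z ∧
      (K ≤ n + 1 → boundedRank K Z = n) ∧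
      (∀ (X : Type u) [CStarAlgebra X], IsSeparableOfBoundedRankLE K n X →
        ∀ g : GroupCStarAlgebra (FreeGroup ℕ) →⋆ₐ[ℂ] X,
          ∃ h : Z →⋆ₐ[ℂ] X, g = h.comp p) ∧
      (∀ (X : Type u) [CStarAlgebra X], IsSeparableOfBoundedRankLE K n X →
        ∃ q : Z →⋆ₐ[ℂ] X, Function.Surjective q) := by
  have hP : BoundedRankLE K n (BoundedRankIndex.Product K n) :=
    BoundedRankLE.lp hK fun t => t.isSeparableOfBoundedRankLE.2
  have hc : Countable (FreeGroup ℕ) := Quot.mk_surjective.countable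
  obtain ⟨A, hA, hS, hAsep⟩ := hP.exists_separable_subalgebra
    -- The images of the countably many group elements suffice: any closed ⋆-subalgebra containing
    -- them contains the whole image of the diagonal map.
    (Set.countable_range fun g : FreeGroup ℕ =>
      BoundedRankIndex.diagonal K n (GroupCStarAlgebra.ι (MonoidAlgebra.single g 1)))
  have hp : ∀ x, BoundedRankIndex.diagonal K n x ∈ A :=
    GroupCStarAlgebra.apply_mem_of_forall_single_mem _ A hA fun g => hS ⟨g, rfl⟩
  refine ⟨A, inferInstance, (BoundedRankIndex.diagonal K n).codRestrict A hp, hAsep,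
    fun hKn => ?_, fun X _ => isBoundedRankInvertible_codRestrict A hp X,
    fun X _ => (isBoundedRankInvertible_codRestrict A hp X).exists_surjective⟩
  -- A smaller bound for the universal algebra would pass to its quotient `X`, which satisfies none.
  obtain ⟨X, _, hX, hX'⟩ := exists_boundedRankLE_and_not hK hKn
  obtain ⟨q, hq⟩ := (isBoundedRankInvertible_codRestrict A hp X).exists_surjective hX
  exact boundedRank_eq_of_forall_not hAsep.2 fun m hm h => hX' m hm (h.of_surjective q hq)
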